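/- Let $G$ be a finite simple connected bridgeless cubic graph. A $4$-edge-colouring of $G$ is a map $f\colon E(G)\to\{1,2,3,4\}$ with $f(e)\neq f(e')$ whenever $e\neq e'$ share a vertex. For such an $f$, an edge $e$ is rich if exactly four colours appear on the edges adjacent to $e$ (the edges other than $e$ that share a vertex with $e$), poor if exactly two colours appear on these edges, and medium if it is neither rich nor poor. Then $G$ has a $4$-edge-colouring with at most $\frac45|V(G)|$ medium edges. Moreover, every $4$-edge-colouring of $G$ has at least $\frac45|V(G)|$ medium edges if and only if $G$ is isomorphic to the Petersen graph. -/

import Mathlib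

/-- A `k`-edge-colouring of `G`: a map from the edges of `G` to `k` colours such that two distinct
edges sharing a vertex receive distinct colours. -/
abbrev EdgeColouring {V : Type*} (G : SimpleGraph V) (k : ℕ) : Type _ :=
  G.lineGraph.Coloring (Fin k)

namespace EdgeColouring

variable {V : Type*} {G : SimpleGraph V} {k : ℕ}

/-- The set of colours on the edges adjacent to `e` (the edge `e` itself is not included). -/
def adjacentColours (f : EdgeColouring G k) (e : G.edgeSet) : Set (Fin k) :=
  f '' G.lineGraph.neighborSet e

/-- `e` is rich if exactly four colours appear on the edges adjacent to `e`. -/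
def IsRich (f : EdgeColouring G k) (e : G.edgeSet) : Prop :=
  (adjacentColours f e).ncard = 4

/-- `e` is poor if exactly two colours appear on the edges adjacent to `e`. -/
def IsPoor (f : EdgeColouring G k) (e : G.edgeSet) : Prop :=
  (adjacentColours f e).ncard = 2

/-- `e` is medium if it is neither rich nor poor. -/
def IsMedium (f : EdgeColouring G k) (e : G.edgeSet) : Prop :=
  ¬ IsRich f e ∧ ¬ IsPoor f e

/-- The number of medium edges (used for finite graphs only). -/
noncomputable def numMedium (f : EdgeColouring G k) : ℕ :=
  {e : G.edgeSet | IsMedium f e}.ncard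

end EdgeColouring

/-- No edge of `G` is a bridge. -/
def IsBridgeless {V : Type*} (G : SimpleGraph V) : Prop :=
  ∀ e ∈ G.edgeSet, ¬ G.IsBridge e

/-- The Petersen graph, as the Kneser graph on the `2`-element subsets of a `5`-element set:
two such subsets are adjacent if and only if they are disjoint. -/
def petersenGraph : SimpleGraph {s : Finset (Fin 5) // s.card = 2} where
  Adj s t := Disjoint s.1 t.1
  symm := ⟨fun _ _ h => h.symm⟩
  loopless := ⟨fun s h => by
    have h0 : s.1 = ∅ := by simpa using h
    have h2 := s.2
    simp [h0] at h2⟩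

/-! Since only four colours are used, an edge `uv` is medium exactly when the colours missing at `u`
and at `v` differ. The upper bound therefore asks for a colouring whose missing colours rarely
change along an edge.

Choose a perfect matching `μ` that meets every odd 3-edge cut in exactly one edge
(`IsCubicWeight.exists_isTightMatching`). Such a matching is found by contracting the two sides of
nontrivial 3-edge cuts, gluing, and uncrossing; with no such cut left, Tutte's theorem supplies a
perfect matching through any given edge. The complementary 2-factor is oriented as a permutation
`σ`. An odd union of its cycles is left by matching edges only, so its cut is odd, at least 3 and
not 3: at least five matching edges leave it.

Colour the matching with 3. Alternate 0 and 1 on the cycles, with a single edge of colour 2 on each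
odd cycle. The missing colour is 2 except at the ends of that edge, where it is 0 and 1. Each odd
cycle then accounts for at most three medium edges on the cycle and two in the matching. A matching
edge joining two exceptional vertices with the same missing colour is not medium, which saves two.
Let `n` be the number of vertices and `k` the number of odd cycles. Tutte's theorem on the graph of
odd cycles, combined with the five-edge bound, matches all but at most `d` of them, where `d` is the
largest even number with `5 * d ≤ n - 5 * k`. This leaves at most `4 * k + d` medium edges, hence at
most `4 * n / 5`.

If no colouring does better, then `n = 5 * k`, all cycles are pentagons, and they are perfectly
matched through chosen representatives. Every way of saving one more edge is now forbidden. Varying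
the exceptional vertices shows that every matching edge stays within a matched pair of pentagons, so
by connectedness there are only two pentagons. Adjacent vertices of one are then matched to
nonadjacent vertices of the other, which is the Petersen graph.

Conversely, a finite enumeration shows that a 4-edge-colouring of the Petersen graph has at most 7
poor edges. No edge is rich with four colours, so at least 8 of the 15 edges are medium. -/

open Finset

/-! ### Tutte's theorem -/

/-- A perfect matching of a graph, described as an involution along the edges. -/
theorem SimpleGraph.Subgraph.IsPerfectMatching.exists_involution {V : Type*} {G : SimpleGraph V}
    {M : G.Subgraph} (hM : M.IsPerfectMatching) :
    ∃ μ : V → V, (∀ v, μ (μ v) = v) ∧ ∀ v, G.Adj v (μ v) := by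
  rw [SimpleGraph.Subgraph.isPerfectMatching_iff] at hM
  choose μ h1 h2 using hM
  exact ⟨μ, fun v => (h2 _ _ (h1 v).symm).symm, fun v => (h1 v).adj_sub⟩

/-- Tutte's theorem in terms of families of odd sets. -/
theorem SimpleGraph.exists_involution_or_odd_sets {V : Type*} [Fintype V] [DecidableEq V]
    (G : SimpleGraph V) :
    (∃ μ : V → V, (∀ v, μ (μ v) = v) ∧ ∀ v, G.Adj v (μ v)) ∨
    ∃ (S : Finset V) (Q : Finset (Finset V)), S.card < Q.card ∧
      (Odd (Q.card + S.card) ↔ Odd (Fintype.card V)) ∧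
      (∀ A ∈ Q, Odd A.card) ∧ (∀ A ∈ Q, Disjoint A S) ∧
      (∀ A ∈ Q, ∀ B ∈ Q, A ≠ B → Disjoint A B) ∧
      ∀ A ∈ Q, ∀ u ∈ A, ∀ v, G.Adj u v → v ∉ A → v ∈ S := by
  classical
  by_cases h : ∃ M : G.Subgraph, M.IsPerfectMatching
  · obtain ⟨M, hM⟩ := h
    exact Or.inl hM.exists_involution
  right
  rw [SimpleGraph.tutte] at h
  push Not at h
  obtain ⟨u, hu⟩ := h
  unfold SimpleGraph.IsTutteViolator at hu
  set H := ((⊤ : G.Subgraph).deleteVerts u) with hH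
  have hverts : H.verts = uᶜ := by simp [hH, Set.compl_eq_univ_sdiff]
  have hnot : ∀ x : H.verts, (x : V) ∉ u := fun x => by
    have hx : (x : V) ∈ uᶜ := hverts ▸ x.2
    exact hx
  have hadj : ∀ x y : H.verts, G.Adj x y → H.coe.Adj x y := by
    intro x y hxy
    have hx := hnot x
    have hy := hnot y
    simp [hH, hxy, hx, hy]
  let img : H.coe.ConnectedComponent → Finset V :=
    fun c => (Set.toFinset c.supp).image Subtype.val
  have himg : Function.Injective img := by
    intro c d hcd
    have := Finset.image_injective Subtype.val_injective hcd
    exact SimpleGraph.ConnectedComponent.supp_injective (Set.toFinset_inj.mp this)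
  have hcard : ∀ c, (img c).card = c.supp.ncard := by
    intro c
    rw [Finset.card_image_of_injective _ Subtype.val_injective, Set.ncard_eq_toFinset_card']
  refine ⟨u.toFinset, (Set.toFinset H.coe.oddComponents).image img, ?_, ?_, ?_, ?_, ?_, ?_⟩
  · rw [Finset.card_image_of_injective _ himg, ← Set.ncard_eq_toFinset_card',
      ← Set.ncard_eq_toFinset_card']
    exact hu
  · rw [Finset.card_image_of_injective _ himg, ← Set.ncard_eq_toFinset_card',
      ← Set.ncard_eq_toFinset_card', Nat.odd_add, SimpleGraph.odd_ncard_oddComponents]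
    have h1 : Nat.card H.verts = Fintype.card V - u.ncard := by
      rw [Nat.card_coe_set_eq, hverts, Set.ncard_compl, Nat.card_eq_fintype_card]
    have h2 : u.ncard ≤ Fintype.card V := by
      rw [← Nat.card_eq_fintype_card]; exact Set.ncard_le_card u
    rw [h1]
    grind
  · intro A hA
    simp only [Finset.mem_image, Set.mem_toFinset] at hA
    obtain ⟨c, hc, rfl⟩ := hA
    rw [hcard]
    exact hc
  · intro A hA
    simp only [Finset.mem_image, Set.mem_toFinset] at hA
    obtain ⟨c, hc, rfl⟩ := hA
    rw [Finset.disjoint_left]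
    intro x hx
    simp only [img, Finset.mem_image] at hx
    obtain ⟨y, -, rfl⟩ := hx
    simpa using hnot y
  · intro A hA B hB hAB
    simp only [Finset.mem_image, Set.mem_toFinset] at hA hB
    obtain ⟨c, hc, rfl⟩ := hA
    obtain ⟨d, hd, rfl⟩ := hB
    rw [Finset.disjoint_left]
    intro x hx hx'
    simp only [img, Finset.mem_image, Set.mem_toFinset] at hx hx'
    obtain ⟨y, hy, rfl⟩ := hx
    obtain ⟨z, hz, hzy⟩ := hx'
    have : z = y := Subtype.ext hzy
    subst this
    simp only [SimpleGraph.ConnectedComponent.mem_supp_iff] at hy hz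
    exact hAB (by rw [← hy, ← hz])
  · intro A hA x hx v hxv hv
    simp only [Finset.mem_image, Set.mem_toFinset] at hA
    obtain ⟨c, hc, rfl⟩ := hA
    simp only [img, Finset.mem_image, Set.mem_toFinset] at hx hv
    obtain ⟨y, hy, rfl⟩ := hx
    by_contra hvu
    have hvH : v ∈ H.verts := by rw [hverts]; simpa using hvu
    refine hv ⟨⟨v, hvH⟩, ?_, rfl⟩
    have := (hadj y ⟨v, hvH⟩ hxv).reachable
    simp only [SimpleGraph.ConnectedComponent.mem_supp_iff] at hy ⊢
    rw [← hy]
    exact SimpleGraph.ConnectedComponent.sound this.symm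

/-! ### Contracting one side of a cut -/

section ContractCompl

variable {V : Type*} [DecidableEq V]

/-- The contraction of the complement of `X` to a single point. -/
def contractCompl (X : Finset V) (v : V) : Option {v // v ∈ X} :=
  if h : v ∈ X then some ⟨v, h⟩ else none

theorem contractCompl_eq_some {X : Finset V} {v : V} {x : {v // v ∈ X}} :
    contractCompl X v = some x ↔ v = x := by
  unfold contractCompl
  split_ifs with h
  · simp [Subtype.ext_iff]
  · simp only [false_iff]
    rintro rfl
    exact h x.2

theorem contractCompl_of_mem {X : Finset V} {v : V} (h : v ∈ X) :
    contractCompl X v = some ⟨v, h⟩ :=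
  contractCompl_eq_some.mpr rfl

theorem contractCompl_eq_none {X : Finset V} {v : V} : contractCompl X v = none ↔ v ∉ X := by
  unfold contractCompl
  split_ifs with h <;> simp [h]

end ContractCompl

/-! ### Cuts in weighted cubic graphs -/

section CutWeight

variable {V W : Type*} [Fintype V] [DecidableEq V] [Fintype W] [DecidableEq W]

/-- The total weight of the pairs leaving the set `X`. -/
def cutWeight (w : V → V → ℕ) (X : Finset V) : ℕ :=
  ∑ u, ∑ v, if u ∈ X ∧ v ∉ X then w u v else 0

/-- The total weight of the pairs from `X` to `Y`. -/
def betweenWeight (w : V → V → ℕ) (X Y : Finset V) : ℕ :=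
  ∑ u, ∑ v, if u ∈ X ∧ v ∈ Y then w u v else 0

theorem cutWeight_compl {w : V → V → ℕ} (hw : ∀ u v, w u v = w v u) (X : Finset V) :
    cutWeight w Xᶜ = cutWeight w X := by
  unfold cutWeight
  rw [Finset.sum_comm]
  refine Finset.sum_congr rfl fun u _ => Finset.sum_congr rfl fun v _ => ?_
  rw [hw v u]
  simp [and_comm]

/-- This is submodularity with its error term. It is used both for the graph and for the indicator
of a matching, so that equality for the former passes to the latter. -/
theorem cutWeight_inter_add_union (w : V → V → ℕ) (A B : Finset V) :
    cutWeight w (A ∩ B) + cutWeight w (A ∪ B) +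
      (betweenWeight w (A \ B) (B \ A) + betweenWeight w (B \ A) (A \ B)) =
    cutWeight w A + cutWeight w B := by
  unfold cutWeight betweenWeight
  simp only [← Finset.sum_add_distrib]
  refine Finset.sum_congr rfl fun u _ => Finset.sum_congr rfl fun v _ => ?_
  by_cases h1 : u ∈ A <;> by_cases h2 : u ∈ B <;> by_cases h3 : v ∈ A <;> by_cases h4 : v ∈ B <;>
    simp [h1, h2, h3, h4]

theorem even_betweenWeight_self {w : V → V → ℕ} (hw : ∀ u v, w u v = w v u)
    (h0 : ∀ v, w v v = 0) (X : Finset V) : Even (betweenWeight w X X) := by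
  unfold betweenWeight
  rw [← ZMod.natCast_eq_zero_iff_even, ← Fintype.sum_prod_type']
  push_cast
  refine Finset.sum_involution (fun p _ => p.swap) ?_ ?_ (by simp) (by simp)
  · rintro ⟨u, v⟩ -
    simp only [Prod.fst_swap, Prod.snd_swap]
    simp only [hw v u, and_comm (a := v ∈ X), CharTwo.add_self_eq_zero]
  · rintro ⟨u, v⟩ - h heq
    simp only [Prod.swap_prod_mk, Prod.mk.injEq] at heq
    obtain ⟨rfl, -⟩ := heq
    simp [h0] at h

theorem cutWeight_add_betweenWeight (w : V → V → ℕ) (X : Finset V) :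
    cutWeight w X + betweenWeight w X X = ∑ u ∈ X, ∑ v, w u v := by
  unfold cutWeight betweenWeight
  rw [← Finset.sum_add_distrib, ← Finset.sum_subset (Finset.subset_univ X)]
  · refine Finset.sum_congr rfl fun u hu => ?_
    rw [← Finset.sum_add_distrib]
    refine Finset.sum_congr rfl fun v _ => ?_
    by_cases hv : v ∈ X <;> simp [hu, hv]
  · intro u _ hu
    simp [hu]

/-- Weights of cubic multigraphs all of whose odd cuts have at least three edges. -/
structure IsCubicWeight (w : V → V → ℕ) : Prop where
  symm : ∀ u v, w u v = w v u
  loopless : ∀ v, w v v = 0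
  degree : ∀ v, ∑ u, w v u = 3
  three_le : ∀ X : Finset V, Odd X.card → 3 ≤ cutWeight w X

/-- The degree sum `3 * #X` counts the weight inside `X` twice and the cut once. -/
theorem odd_cutWeight {w : V → V → ℕ} (hs : ∀ u v, w u v = w v u) (h0 : ∀ v, w v v = 0)
    (hd : ∀ v, ∑ u, w v u = 3) (X : Finset V) : Odd (cutWeight w X) ↔ Odd X.card := by
  have h1 := cutWeight_add_betweenWeight w X
  have h2 := even_betweenWeight_self hs h0 X
  simp only [hd, Finset.sum_const, smul_eq_mul] at h1
  have h3 : Odd (X.card * 3) ↔ Odd X.card := by simp [Nat.odd_mul, show Odd 3 by decide]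
  rw [← h3, ← h1, Nat.odd_add]
  simp [h2]

theorem IsCubicWeight.even_card {w : V → V → ℕ} (hw : IsCubicWeight w) :
    Even (Fintype.card V) := by
  have := odd_cutWeight hw.symm hw.loopless hw.degree Finset.univ
  rw [← Nat.not_odd_iff_even, ← Finset.card_univ, ← this]
  simp [cutWeight]

theorem cutWeight_singleton {w : V → V → ℕ} (h0 : ∀ v, w v v = 0) (v : V) :
    cutWeight w {v} = ∑ u, w v u := by
  unfold cutWeight
  rw [Finset.sum_eq_single v]
  · refine Finset.sum_congr rfl fun u _ => ?_
    by_cases h : u = v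
    · subst h; simp [h0]
    · simp [h]
  · intro u _ hu
    simp [hu]
  · simp

/-- The weights obtained by contracting the fibres of `φ`. -/
def contractWeight (w : V → V → ℕ) (φ : V → W) (x y : W) : ℕ :=
  if x = y then 0 else ∑ u, ∑ v, if φ u = x ∧ φ v = y then w u v else 0

theorem cutWeight_contractWeight (w : V → V → ℕ) (φ : V → W) (Y : Finset W) :
    cutWeight (contractWeight w φ) Y = cutWeight w {v | φ v ∈ Y} := by
  have h1 : ∀ x y, (if x ∈ Y ∧ y ∉ Y then contractWeight w φ x y else 0) =
      ∑ u, ∑ v, if φ u = x ∧ φ v = y then (if φ u ∈ Y ∧ φ v ∉ Y then w u v else 0) else 0 := by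
    intro x y
    by_cases h : x ∈ Y ∧ y ∉ Y
    · have hne : x ≠ y := by rintro rfl; exact h.2 h.1
      rw [if_pos h, contractWeight, if_neg hne]
      refine Finset.sum_congr rfl fun u _ => Finset.sum_congr rfl fun v _ => ?_
      split_ifs with h2 h3
      · rfl
      · rw [h2.1, h2.2] at h3; exact absurd h h3
      · rfl
    · rw [if_neg h]
      symm
      refine Finset.sum_eq_zero fun u _ => Finset.sum_eq_zero fun v _ => ?_
      split_ifs with h2 h3
      · rw [h2.1, h2.2] at h3; exact absurd h3 h
      · rfl
      · rfl
  unfold cutWeight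
  simp only [h1]
  have h2 : ∀ F : W → W → V → V → ℕ,
      ∑ x, ∑ y, ∑ u, ∑ v, F x y u v = ∑ u, ∑ v, ∑ x, ∑ y, F x y u v := by
    intro F
    have h3 : ∀ x, ∑ y, ∑ u, ∑ v, F x y u v = ∑ u, ∑ v, ∑ y, F x y u v := by
      intro x
      rw [Finset.sum_comm]
      exact Finset.sum_congr rfl fun u _ => Finset.sum_comm
    simp only [h3]
    rw [Finset.sum_comm]
    exact Finset.sum_congr rfl fun u _ => Finset.sum_comm
  calc _ = ∑ u, ∑ v, ∑ x, ∑ y, (if φ u = x ∧ φ v = y then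
        (if φ u ∈ Y ∧ φ v ∉ Y then w u v else 0) else 0) := by
        exact h2 _
    _ = _ := by
        refine Finset.sum_congr rfl fun u _ => Finset.sum_congr rfl fun v _ => ?_
        simp [ite_and]

/-- A cut of the contraction is the cut of its preimage, and odd fibres preserve the parity of sets
under preimage. -/
theorem IsCubicWeight.isCubicWeight_contractWeight {w : V → V → ℕ} (hw : IsCubicWeight w) (φ : V → W)
    (hodd : ∀ x, Odd (#{v | φ v = x})) (hcut : ∀ x, cutWeight w {v | φ v = x} = 3) :
    IsCubicWeight (contractWeight w φ) := by
  have h0 : ∀ x, contractWeight w φ x x = 0 := fun x => by simp [contractWeight]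
  refine ⟨fun x y => ?_, h0, fun x => ?_, fun X hX => ?_⟩
  · unfold contractWeight
    rw [Finset.sum_comm]
    simp only [eq_comm (a := x) (b := y)]
    congr 1
    refine Finset.sum_congr rfl fun u _ => Finset.sum_congr rfl fun v _ => ?_
    rw [hw.symm v u]
    simp only [and_comm]
  · rw [← cutWeight_singleton h0, cutWeight_contractWeight, ← hcut x]
    simp
  · rw [cutWeight_contractWeight]
    refine hw.three_le _ ?_
    rw [Finset.card_eq_sum_card_fiberwise (f := φ) (t := X) (by intro v; simp),
      Finset.odd_sum_iff_odd_card_odd]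
    convert hX using 2
    ext x
    simp only [Finset.mem_filter, and_iff_left_iff_imp]
    intro hx
    have hfib : ({v ∈ ({v | φ v ∈ X} : Finset V) | φ v = x}) = ({v | φ v = x} : Finset V) := by
      ext v
      simp only [Finset.mem_filter, Finset.mem_univ, true_and]
      exact ⟨fun h => h.2, fun h => ⟨h ▸ hx, h⟩⟩
    rw [hfib]
    exact hodd x

theorem IsCubicWeight.isCubicWeight_contractCompl {w : V → V → ℕ} (hw : IsCubicWeight w) {X : Finset V}
    (hX : Odd X.card) (h3 : cutWeight w X = 3) :
    IsCubicWeight (contractWeight w (contractCompl X)) := by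
  refine hw.isCubicWeight_contractWeight _ ?_ ?_
  · rintro (_ | x)
    · have : ({v | contractCompl X v = none} : Finset V) = Xᶜ := by
        ext v; simp [contractCompl_eq_none]
      rw [this, Finset.card_compl]
      have := hw.even_card
      have := Finset.card_le_univ X
      grind
    · simp [contractCompl_eq_some, Finset.filter_eq']
  · rintro (_ | x)
    · have : ({v | contractCompl X v = none} : Finset V) = Xᶜ := by
        ext v; simp [contractCompl_eq_none]
      rw [this, cutWeight_compl hw.symm, h3]
    · have : ({v | contractCompl X v = some x} : Finset V) = {x.1} := by
        ext v; simp [contractCompl_eq_some]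
      rw [this, cutWeight_singleton hw.loopless, hw.degree]

theorem contractWeight_contractCompl_some (w : V → V → ℕ) {X : Finset V} {x y : {v // v ∈ X}}
    (hxy : x ≠ y) :
    contractWeight w (contractCompl X) (some x) (some y) = w x y := by
  unfold contractWeight
  rw [if_neg (by simpa using hxy)]
  simp [contractCompl_eq_some, ite_and]

theorem contractWeight_contractCompl_none (w : V → V → ℕ) {X : Finset V} (x : {v // v ∈ X}) :
    contractWeight w (contractCompl X) (some x) none = ∑ v, if v ∉ X then w x v else 0 := by
  unfold contractWeight
  rw [if_neg (by simp)]
  simp [contractCompl_eq_some, contractCompl_eq_none, ite_and]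

end CutWeight

/-! ### Perfect matchings through a prescribed edge -/

section ThroughEdge

variable {V : Type*} [Fintype V] [DecidableEq V]

/-- Each member of `Q` sends at least three edges, all of them into `S`. The degrees in `S` sum to
`3 * #S`, and part of this is spent on the edge `ab` inside `S`, so the inequality is strict. -/
theorem IsCubicWeight.card_lt_card {w : V → V → ℕ} (hw : IsCubicWeight w) {a b : V}
    (hab : 0 < w a b) {S : Finset V} {Q : Finset (Finset V)} (ha : a ∈ S) (hb : b ∈ S)
    (hodd : ∀ A ∈ Q, Odd A.card) (hS : ∀ A ∈ Q, Disjoint A S)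
    (hQ : ∀ A ∈ Q, ∀ B ∈ Q, A ≠ B → Disjoint A B)
    (hclosed : ∀ A ∈ Q, ∀ u ∈ A, ∀ v, 0 < w u v → v ∉ A → v ∈ S) : Q.card < S.card := by
  have h1 : ∀ A ∈ Q, cutWeight w A ≤ ∑ u ∈ A, ∑ v ∈ S, w u v := by
    intro A hA
    unfold cutWeight
    rw [← Finset.sum_subset (Finset.subset_univ A) (by intro u _ hu; simp [hu])]
    refine Finset.sum_le_sum fun u hu => ?_
    rw [← Finset.sum_subset (Finset.subset_univ S)]
    · refine Finset.sum_le_sum fun v _ => ?_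
      split_ifs <;> simp
    · intro v _ hv
      split_ifs with h
      · by_contra h0
        exact hv (hclosed A hA u hu v (Nat.pos_of_ne_zero h0) h.2)
      · rfl
  have h2 : 3 * Q.card ≤ ∑ A ∈ Q, ∑ u ∈ A, ∑ v ∈ S, w u v := by
    rw [mul_comm, ← smul_eq_mul, ← Finset.sum_const]
    exact Finset.sum_le_sum fun A hA => (hw.three_le A (hodd A hA)).trans (h1 A hA)
  have h3 : ∑ A ∈ Q, ∑ u ∈ A, ∑ v ∈ S, w u v ≤ ∑ v ∈ S, ∑ u ∈ Sᶜ, w v u := by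
    rw [Finset.sum_comm (s := S) (t := Sᶜ)]
    simp only [hw.symm]
    have h4 := Finset.sum_biUnion (s := Q) (t := id) (f := fun u => ∑ v ∈ S, w u v)
      (fun A hA B hB hAB => hQ A hA B hB hAB)
    simp only [id] at h4
    rw [← h4]
    refine Finset.sum_le_sum_of_subset fun u hu => ?_
    simp only [Finset.mem_biUnion, id] at hu
    obtain ⟨A, hA, hu⟩ := hu
    simpa using Finset.disjoint_left.mp (hS A hA) hu
  have h5 : ∑ v ∈ S, ∑ u ∈ Sᶜ, w v u < ∑ v ∈ S, 3 := by
    refine Finset.sum_lt_sum (fun v _ => ?_) ⟨a, ha, ?_⟩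
    · rw [← hw.degree v]
      exact Finset.sum_le_sum_of_subset (Finset.subset_univ _)
    · rw [← hw.degree a]
      exact Finset.sum_lt_sum_of_subset (Finset.subset_univ _) (Finset.mem_univ b) (by simpa) hab
        (by simp)
  rw [Finset.sum_const, smul_eq_mul] at h5
  omega

/-- Delete all edges at `a` and `b` except `ab`. A perfect matching of what remains must use `ab`. A
Tutte violator there is altered, by putting `a` and `b` into `S`, until it contradicts
`IsCubicWeight.card_lt_card`. -/
theorem IsCubicWeight.exists_involution_through {w : V → V → ℕ} (hw : IsCubicWeight w) {a b : V}
    (hab : 0 < w a b) :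
    ∃ μ : V → V, (∀ v, μ (μ v) = v) ∧ (∀ v, 0 < w v (μ v)) ∧ μ a = b := by
  have hne : a ≠ b := by rintro rfl; simp [hw.loopless] at hab
  let G : SimpleGraph V :=
    { Adj := fun u v => (u ≠ a ∧ u ≠ b ∧ v ≠ a ∧ v ≠ b ∧ 0 < w u v) ∨ (u = a ∧ v = b) ∨
        (u = b ∧ v = a)
      symm := ⟨fun u v h => by
        rcases h with ⟨h1, h2, h3, h4, h5⟩ | h | h
        · exact Or.inl ⟨h3, h4, h1, h2, by rwa [hw.symm]⟩
        · exact Or.inr (Or.inr h.symm)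
        · exact Or.inr (Or.inl h.symm)⟩
      loopless := ⟨fun u h => by
        rcases h with h | h | h
        · simp [hw.loopless] at h
        · exact hne (h.1.symm.trans h.2)
        · exact hne (h.2.symm.trans h.1)⟩ }
  have hG : ∀ u v, G.Adj u v ↔ (u ≠ a ∧ u ≠ b ∧ v ≠ a ∧ v ≠ b ∧ 0 < w u v) ∨ (u = a ∧ v = b) ∨
        (u = b ∧ v = a) := fun u v => Iff.rfl
  rcases G.exists_involution_or_odd_sets with ⟨μ, h1, h2⟩ | ⟨S, Q, hlt, hpar, hodd, hS, hQ, hcl⟩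
  · refine ⟨μ, h1, fun v => ?_, ?_⟩
    · rcases (hG _ _).mp (h2 v) with h | h | h
      · exact h.2.2.2.2
      · rw [h.2, h.1]; exact hab
      · rw [h.2, h.1, hw.symm]; exact hab
    · rcases (hG _ _).mp (h2 a) with h | h | h
      · exact absurd rfl h.1
      · exact h.2
      · exact absurd h.1 hne
  exfalso
  -- The number of vertices is even, so `#Q` and `#S` have the same parity and the violation is by
  -- at least two.
  have hQS : S.card + 2 ≤ Q.card := by
    have := hw.even_card
    rw [← Nat.not_odd_iff_even, ← hpar] at this
    rw [Nat.not_odd_iff_even] at this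
    grind
  have hab1 : ∀ A ∈ Q, a ∈ A → b ∉ A → b ∈ S := fun A hA h h' =>
    hcl A hA a h b ((hG _ _).mpr (Or.inr (Or.inl ⟨rfl, rfl⟩))) h'
  have hab2 : ∀ A ∈ Q, b ∈ A → a ∉ A → a ∈ S := fun A hA h h' =>
    hcl A hA b h a ((hG _ _).mpr (Or.inr (Or.inr ⟨rfl, rfl⟩))) h'
  have hcl' : ∀ A ∈ Q, ∀ u ∈ A, u ≠ a → u ≠ b → ∀ v, 0 < w u v → v ∉ A → v ≠ a → v ≠ b → v ∈ S :=
    fun A hA u hu h1 h2 v h3 h4 h5 h6 =>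
      hcl A hA u hu v ((hG _ _).mpr (Or.inl ⟨h1, h2, h5, h6, h3⟩)) h4
  -- If one end is already in `S`, adding both enlarges `S` by at most one. Only a member of `Q`
  -- containing the other end is lost, and there is at most one.
  by_cases haS : a ∈ S ∨ b ∈ S
  · set Q' := {A ∈ Q | a ∉ A ∧ b ∉ A} with hQ'
    have hsub : ∀ A ∈ Q', A ∈ Q ∧ a ∉ A ∧ b ∉ A := fun A hA => by simpa [hQ'] using hA
    have hlt' := hw.card_lt_card hab (S := insert a (insert b S)) (Q := Q')
      (by simp) (by simp) (fun A hA => hodd A (hsub A hA).1) (fun A hA => by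
        simp only [Finset.disjoint_insert_right]
        exact ⟨(hsub A hA).2.1, (hsub A hA).2.2, hS A (hsub A hA).1⟩)
      (fun A hA B hB => hQ A (hsub A hA).1 B (hsub B hB).1)
      (fun A hA u hu v hv hvA => by
        obtain ⟨h1, h2, h3⟩ := hsub A hA
        by_cases hva : v = a
        · simp [hva]
        by_cases hvb : v = b
        · simp [hvb]
        have := hcl' A h1 u hu (by rintro rfl; exact h2 hu) (by rintro rfl; exact h3 hu) v hv hvA
          hva hvb
        simp [this])
    have hcard : (insert a (insert b S)).card ≤ S.card + 1 := by
      rcases haS with h | h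
      · rw [Finset.insert_eq_of_mem (by simp [h])]
        exact Finset.card_insert_le _ _
      · rw [Finset.insert_eq_of_mem h]
        exact Finset.card_insert_le _ _
    have hrest : (Q \ Q').card ≤ 1 := by
      rw [Finset.card_le_one]
      intro A hA B hB
      simp only [hQ', Finset.mem_sdiff, Finset.mem_filter, not_and, not_not] at hA hB
      by_contra hne
      have hdis := Finset.disjoint_left.mp (hQ A hA.1 B hB.1 hne)
      have hAS := Finset.disjoint_left.mp (hS A hA.1)
      have hBS := Finset.disjoint_left.mp (hS B hB.1)
      have h1 := hA.2 hA.1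
      have h2 := hB.2 hB.1
      rcases haS with h | h
      · exact hdis (h1 fun h' => hAS h' h) (h2 fun h' => hBS h' h)
      · have h3 : a ∈ A := by by_contra h'; exact hAS (h1 h') h
        have h4 : a ∈ B := by by_contra h'; exact hBS (h2 h') h
        exact hdis h3 h4
    have := Finset.card_le_card_sdiff_add_card (s := Q) (t := Q')
    omega
  -- If neither end is in `S`, each member of `Q` contains both ends or neither. Removing them
  -- preserves oddness, while `S` grows by at most two.
  · push Not at haS
    obtain ⟨haS, hbS⟩ := haS
    have hiff : ∀ A ∈ Q, (a ∈ A ↔ b ∈ A) := fun A hA =>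
      ⟨fun h => by by_contra h'; exact hbS (hab1 A hA h h'),
        fun h => by by_contra h'; exact haS (hab2 A hA h h')⟩
    have hodd' : ∀ A ∈ Q, Odd (A \ {a, b}).card := by
      intro A hA
      by_cases h : a ∈ A
      · have hsub : ({a, b} : Finset V) ⊆ A := by
          intro x hx
          simp only [Finset.mem_insert, Finset.mem_singleton] at hx
          rcases hx with rfl | rfl
          · exact h
          · exact (hiff A hA).mp h
        have h1 := Finset.card_sdiff_add_card_eq_card hsub
        have h2 := hodd A hA
        rw [← h1, Finset.card_pair hne] at h2
        grind
      · have : A \ {a, b} = A := by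
          rw [Finset.sdiff_eq_self_iff_disjoint]
          simp [h, (hiff A hA).not.mp h]
        rw [this]
        exact hodd A hA
    have hinj : Set.InjOn (fun A : Finset V => A \ {a, b}) Q := by
      intro A hA B hB hAB
      by_contra hne
      have hdis := Finset.disjoint_left.mp (hQ A hA B hB hne)
      obtain ⟨x, hx⟩ := Finset.card_pos.mp (hodd' A hA).pos
      have hx' : x ∈ B \ {a, b} := by
        have h : A \ {a, b} = B \ {a, b} := hAB
        rw [← h]; exact hx
      exact hdis (Finset.mem_sdiff.mp hx).1 (Finset.mem_sdiff.mp hx').1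
    have hlt' := hw.card_lt_card hab (S := insert a (insert b S))
      (Q := Q.image fun A => A \ {a, b}) (by simp) (by simp)
      (by simpa using hodd')
      (by
        intro A hA
        obtain ⟨B, hB, rfl⟩ := Finset.mem_image.mp hA
        simp only [Finset.disjoint_insert_right]
        exact ⟨by simp, by simp, (hS B hB).mono_left Finset.sdiff_subset⟩)
      (by
        intro A hA A' hA' hne'
        obtain ⟨B, hB, rfl⟩ := Finset.mem_image.mp hA
        obtain ⟨B', hB', rfl⟩ := Finset.mem_image.mp hA'
        exact (hQ B hB B' hB' (by rintro rfl; exact hne' rfl)).mono Finset.sdiff_subset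
          Finset.sdiff_subset)
      (by
        intro A hA u hu v hv hvA
        obtain ⟨B, hB, rfl⟩ := Finset.mem_image.mp hA
        simp only [Finset.mem_sdiff, Finset.mem_insert, Finset.mem_singleton, not_or, not_and,
          not_not] at hu hvA
        by_cases hva : v = a
        · simp [hva]
        by_cases hvb : v = b
        · simp [hvb]
        have := hcl' B hB u hu.1 hu.2.1 hu.2.2 v hv (fun h => hvb (hvA h hva)) hva hvb
        simp [this])
    rw [Finset.card_image_of_injOn hinj] at hlt'
    have h1 := Finset.card_insert_le a (insert b S)
    have h2 := Finset.card_insert_le b S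
    omega

end ThroughEdge

/-! ### Gluing matchings along tight cuts -/

section TightCuts

/-- The number of elements of `X` sent out of `X` by `μ`. -/
def crossing {V : Type*} [DecidableEq V] (μ : V → V) (X : Finset V) : ℕ := #{v ∈ X | μ v ∉ X}

theorem crossing_eq_cutWeight {V : Type*} [Fintype V] [DecidableEq V] (μ : V → V) (X : Finset V) :
    crossing μ X = cutWeight (fun u v => if v = μ u then 1 else 0) X := by
  unfold crossing cutWeight
  rw [Finset.card_filter, ← Finset.sum_subset (Finset.subset_univ X)]
  · refine Finset.sum_congr rfl fun u hu => ?_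
    rw [Finset.sum_eq_single (μ u)]
    · simp [hu]
    · intro v _ hv
      simp [hv]
    · simp
  · intro u _ hu
    simp [hu]

/-- A perfect matching along edges of positive weight that meets every tight odd cut in exactly
one edge. -/
structure IsTightMatching {V : Type*} [Fintype V] [DecidableEq V] (w : V → V → ℕ) (μ : V → V) :
    Prop where
  invol : ∀ v, μ (μ v) = v
  pos : ∀ v, 0 < w v (μ v)
  tight : ∀ X : Finset V, Odd X.card → cutWeight w X = 3 → crossing μ X = 1

variable {V : Type*} [Fintype V] [DecidableEq V]

/-- The part inside `X` of a tight matching of the graph with the complement of `X` contracted. -/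
theorem IsCubicWeight.exists_side {w : V → V → ℕ} (hw : IsCubicWeight w) {X : Finset V}
    (ih : ∀ a b, 0 < contractWeight w (contractCompl X) a b →
      ∃ μ, IsTightMatching (contractWeight w (contractCompl X)) μ ∧ μ a = b)
    {p q : V} (hp : p ∈ X) (hpq : 0 < w p q) :
    ∃ u z, u ∈ X ∧ z ∉ X ∧ 0 < w u z ∧ (q ∉ X → u = p) ∧ ∃ η : V → V,
      (∀ v ∈ X, v ≠ u → η v ∈ X ∧ η v ≠ u ∧ η (η v) = v ∧ 0 < w v (η v)) ∧
      (q ∈ X → p ≠ u ∧ η p = q) ∧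
      ∀ Y ⊆ X, Odd Y.card → cutWeight w Y = 3 → #{v ∈ Y | v = u ∨ η v ∉ Y} = 1 := by
  have hpq' : 0 < contractWeight w (contractCompl X) (some ⟨p, hp⟩) (contractCompl X q) := by
    by_cases hq : q ∈ X
    · rw [contractCompl_of_mem (hq), contractWeight_contractCompl_some]
      · exact hpq
      · rintro h
        rw [Subtype.mk.injEq] at h
        subst h
        simp [hw.loopless] at hpq
    · rw [contractCompl_eq_none.mpr hq, contractWeight_contractCompl_none]
      refine lt_of_lt_of_le hpq ?_
      have := Finset.single_le_sum (f := fun v => if v ∉ X then w p v else 0)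
        (fun i _ => Nat.zero_le _) (Finset.mem_univ q)
      simpa [hq] using this
  obtain ⟨μ, hμ, hμp⟩ := ih _ _ hpq'
  have hne : ∀ x, μ x ≠ x := by
    intro x hx
    have := hμ.pos x
    rw [hx] at this
    simp [contractWeight] at this
  obtain ⟨u, hu⟩ : ∃ u, μ none = some u := Option.ne_none_iff_exists'.mp (hne none)
  have hu' : μ (some u) = none := by rw [← hu, hμ.invol]
  have hz : ∃ z, z ∉ X ∧ 0 < w u z := by
    have h1 := hμ.pos (some u)
    rw [hu', contractWeight_contractCompl_none] at h1
    obtain ⟨z, -, hz⟩ := Finset.exists_ne_zero_of_sum_ne_zero h1.ne'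
    simp only [ne_eq, ite_eq_right_iff, not_forall] at hz
    exact ⟨z, hz.1, Nat.pos_of_ne_zero hz.2⟩
  obtain ⟨z, hzX, hz⟩ := hz
  -- Inside `X` the default value occurs only at `u`, which is matched to the contracted point; `η
  -- u` is never relied upon.
  let η : V → V := fun v => (μ (contractCompl X v)).elim v Subtype.val
  have hη : ∀ v (hv : v ∈ X), v ≠ u → μ (some ⟨v, hv⟩) = contractCompl X (η v) ∧ η v ∈ X := by
    intro v hv hvu
    have h1 : contractCompl X v = some ⟨v, hv⟩ := contractCompl_eq_some.mpr rfl
    obtain ⟨x, hx⟩ : ∃ x, μ (some ⟨v, hv⟩) = some x := by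
      rw [← Option.ne_none_iff_exists']
      intro h
      have : μ none = some ⟨v, hv⟩ := by rw [← h, hμ.invol]
      rw [hu, Option.some.injEq] at this
      exact hvu (by rw [this])
    have h2 : η v = x := by simp [η, h1, hx]
    rw [h2]
    exact ⟨by rw [hx]; exact (contractCompl_eq_some.mpr rfl).symm, x.2⟩
  refine ⟨u, z, u.2, hzX, hz, ?_, η, ?_, ?_, ?_⟩
  · intro hq
    rw [contractCompl_eq_none.mpr hq] at hμp
    have : μ none = some ⟨p, hp⟩ := by rw [← hμp, hμ.invol]
    rw [hu, Option.some.injEq] at this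
    rw [this]
  · intro v hv hvu
    obtain ⟨h1, h2⟩ := hη v hv hvu
    have h3 : contractCompl X (η v) = some ⟨η v, h2⟩ := contractCompl_eq_some.mpr rfl
    have h4 : η v ≠ u := by
      intro h
      have : contractCompl X (η v) = some u := contractCompl_eq_some.mpr h
      rw [this] at h1
      have h5 := hμ.invol (some ⟨v, hv⟩)
      rw [h1, hu'] at h5
      simp at h5
    refine ⟨h2, h4, ?_, ?_⟩
    · obtain ⟨h5, h6⟩ := hη (η v) h2 h4
      rw [← h3, ← h1, hμ.invol] at h5
      exact (contractCompl_eq_some.mp h5.symm)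
    · have h5 := hμ.pos (some ⟨v, hv⟩)
      rw [h1, h3, contractWeight_contractCompl_some] at h5
      · exact h5
      · intro h
        exact hne (some ⟨v, hv⟩) (by rw [h1, h3, ← h])
  · intro hq
    have h1 : p ≠ u := by
      rintro rfl
      rw [contractCompl_of_mem (hq), hu'] at hμp
      simp at hμp
    refine ⟨h1, ?_⟩
    obtain ⟨h2, h3⟩ := hη p hp h1
    rw [hμp, contractCompl_of_mem (h3)] at h2
    exact (contractCompl_eq_some.mp h2).symm
  · intro Y hYX hYodd hY3
    set Y' : Finset (Option {v // v ∈ X}) := Y.image (contractCompl X) with hY'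
    have hpre : ({v | contractCompl X v ∈ Y'} : Finset V) = Y := by
      ext v
      simp only [hY', Finset.mem_filter, Finset.mem_univ, true_and, Finset.mem_image]
      constructor
      · rintro ⟨y, hy, hyv⟩
        rw [contractCompl_of_mem (hYX hy)] at hyv
        rw [contractCompl_eq_some.mp hyv.symm]
        exact hy
      · intro hv
        exact ⟨v, hv, rfl⟩
    have hinj : Set.InjOn (contractCompl X) Y := by
      intro v hv v' hv' h
      rw [contractCompl_of_mem (hYX hv')] at h
      exact contractCompl_eq_some.mp h
    have hmem : ∀ v, contractCompl X v ∈ Y' ↔ v ∈ Y := fun v => by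
      rw [← hpre]; simp
    have h1 := hμ.tight Y' (by rw [hY', Finset.card_image_of_injOn hinj]; exact hYodd)
      (by rw [cutWeight_contractWeight, hpre, hY3])
    rw [← h1]
    unfold crossing
    have h2 : ({v ∈ Y' | μ v ∉ Y'} : Finset _) =
        ({v ∈ Y | v = u ∨ η v ∉ Y} : Finset V).image (contractCompl X) := by
      ext x
      simp only [Finset.mem_filter, Finset.mem_image]
      constructor
      · rintro ⟨hx, h⟩
        obtain ⟨v, hv, rfl⟩ := Finset.mem_image.mp hx
        refine ⟨v, ⟨hv, ?_⟩, rfl⟩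
        by_contra h'
        push Not at h'
        apply h
        obtain ⟨h3, -⟩ := hη v (hYX hv) h'.1
        rw [contractCompl_of_mem (hYX hv), h3]
        exact (hmem _).mpr h'.2
      · rintro ⟨v, ⟨hv, h⟩, rfl⟩
        refine ⟨(hmem v).mpr hv, fun h' => ?_⟩
        rw [contractCompl_of_mem (hYX hv)] at h'
        by_cases hvu : v = u
        · have : (⟨v, hYX hv⟩ : {v // v ∈ X}) = u := Subtype.ext hvu
          rw [this, hu', ← contractCompl_eq_none.mpr hzX, hmem] at h'
          exact hzX (hYX h')
        · rw [(hη v (hYX hv) hvu).1, hmem] at h'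
          exact h.elim hvu fun h => h h'
    rw [h2, Finset.card_image_of_injOn]
    exact hinj.mono (Finset.filter_subset _ _)

/-- Uncrossing: both the intersection and the union are odd, hence have cuts at least 3, while the
submodularity identity bounds their sum by 6. So there is no slack for edges between the two
differences. -/
theorem cutWeight_pos_edges {w : V → V → ℕ} (hw : IsCubicWeight w) {X Y : Finset V}
    (hX : Odd X.card) (hX3 : cutWeight w X = 3) (hY : Odd Y.card) (hY3 : cutWeight w Y = 3)
    (hXY : Odd (X ∩ Y).card) :
    cutWeight w (X ∩ Y) = 3 ∧ cutWeight w (X ∪ Y) = 3 ∧ Odd (X ∪ Y).card ∧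
      betweenWeight w (X \ Y) (Y \ X) = 0 ∧ betweenWeight w (Y \ X) (X \ Y) = 0 := by
  have h1 := cutWeight_inter_add_union w X Y
  have h2 := Finset.card_union_add_card_inter X Y
  have h3 : Odd (X ∪ Y).card := by grind
  have h4 := hw.three_le _ hXY
  have h5 := hw.three_le _ h3
  refine ⟨?_, ?_, h3, ?_, ?_⟩ <;> omega

theorem betweenWeight_eq_zero_of_le {w : V → V → ℕ} {μ : V → V} (hμ : ∀ v, 0 < w v (μ v))
    {X Y : Finset V} (h : betweenWeight w X Y = 0) :
    betweenWeight (fun u v => if v = μ u then 1 else 0) X Y = 0 := by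
  unfold betweenWeight at h ⊢
  simp only [Finset.sum_eq_zero_iff, Finset.mem_univ, true_imp_iff] at h ⊢
  intro u v
  have h1 := h u v
  split_ifs with h2 h3
  · rw [if_pos h2, h3] at h1
    exact absurd h1 (hμ u).ne'
  · rfl
  · rfl

theorem crossing_compl {μ : V → V} (hμ : ∀ v, μ (μ v) = v) (X : Finset V) :
    crossing μ Xᶜ = crossing μ X := by
  rw [crossing_eq_cutWeight, crossing_eq_cutWeight, cutWeight_compl]
  intro u v
  have : v = μ u ↔ u = μ v := ⟨fun h => by rw [h, hμ], fun h => by rw [h, hμ]⟩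
  simp only [this]

/-- Tight matchings on both sides of a tight odd cut yield a tight matching. -/
theorem IsCubicWeight.isTightMatching_of_laminar {w : V → V → ℕ} (hw : IsCubicWeight w)
    {X : Finset V} (hX : Odd X.card) (hX3 : cutWeight w X = 3) {μ : V → V}
    (h1 : ∀ v, μ (μ v) = v) (h2 : ∀ v, 0 < w v (μ v))
    (hin : ∀ Y ⊆ X, Odd Y.card → cutWeight w Y = 3 → crossing μ Y = 1)
    (hout : ∀ Y ⊆ Xᶜ, Odd Y.card → cutWeight w Y = 3 → crossing μ Y = 1) :
    IsTightMatching w μ := by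
  have heven := hw.even_card
  have hcompl : ∀ Y : Finset V, Odd Y.card → Odd Yᶜ.card := by
    intro Y hY
    have := Finset.card_add_card_compl Y
    grind
  have key : ∀ Y : Finset V, Odd Y.card → cutWeight w Y = 3 → Odd (X ∩ Y).card →
      crossing μ Y = 1 := by
    intro Y hY hY3 hXY
    obtain ⟨h3, h4, h5, h6, h7⟩ := cutWeight_pos_edges hw hX hX3 hY hY3 hXY
    have h8 := cutWeight_inter_add_union (fun u v => if v = μ u then 1 else 0) X Y
    rw [betweenWeight_eq_zero_of_le h2 h6, betweenWeight_eq_zero_of_le h2 h7] at h8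
    simp only [← crossing_eq_cutWeight] at h8
    have h9 := hin _ Finset.inter_subset_left hXY h3
    have h10 := hin X subset_rfl hX hX3
    have h11 := hout (X ∪ Y)ᶜ (by rw [Finset.compl_subset_compl]; exact Finset.subset_union_left)
      (hcompl _ h5) (by rw [cutWeight_compl hw.symm, h4])
    rw [crossing_compl h1] at h11
    omega
  refine ⟨h1, h2, fun Y hY hY3 => ?_⟩
  -- Exactly one of `Y` and its complement meets the odd set `X` in an odd set. Uncrossing expresses
  -- the crossing number of that one through those of `X`, a subset of `X`, and a subset of the
  -- complement.
  by_cases hXY : Odd (X ∩ Y).card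
  · exact key Y hY hY3 hXY
  · rw [← crossing_compl h1]
    refine key _ (hcompl _ hY) (by rw [cutWeight_compl hw.symm, hY3]) ?_
    have h3 := Finset.card_sdiff_add_card_inter X Y
    rw [← Finset.sdiff_eq_inter_compl]
    grind

end TightCuts

/-- In a cubic weighted graph without odd cuts smaller than three, every edge lies in a perfect
matching that meets every odd cut of size three exactly once. -/
theorem IsCubicWeight.exists_isTightMatching.{u} {V : Type u} [Fintype V] [DecidableEq V]
    {w : V → V → ℕ} (hw : IsCubicWeight w) {a b : V} (hab : 0 < w a b) :
    ∃ μ, IsTightMatching w μ ∧ μ a = b := by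
  induction hn : Fintype.card V using Nat.strong_induction_on generalizing V with
  | _ n ih =>
  subst hn
  have hne : a ≠ b := by rintro rfl; simp [hw.loopless] at hab
  by_cases hX : ∃ X : Finset V, Odd X.card ∧ cutWeight w X = 3 ∧ 1 < X.card ∧ 1 < Xᶜ.card
  · have hX' : ∃ X : Finset V, a ∈ X ∧ Odd X.card ∧ cutWeight w X = 3 ∧ 1 < X.card ∧
        1 < Xᶜ.card := by
      obtain ⟨X, h1, h2, h3, h4⟩ := hX
      by_cases ha : a ∈ X
      · exact ⟨X, ha, h1, h2, h3, h4⟩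
      · refine ⟨Xᶜ, by simpa, ?_, by rw [cutWeight_compl hw.symm, h2], h4, by rwa [compl_compl]⟩
        have := Finset.card_add_card_compl X
        have := hw.even_card
        grind
    obtain ⟨X, ha, hX, hX3, hX1, hXc1⟩ := hX'
    have hXc : Odd Xᶜ.card := by
      have := Finset.card_add_card_compl X
      have := hw.even_card
      grind
    have hXc3 : cutWeight w Xᶜ = 3 := by rw [cutWeight_compl hw.symm, hX3]
    have hcard := Finset.card_add_card_compl X
    have ih1 : ∀ p q, 0 < contractWeight w (contractCompl X) p q →
        ∃ μ, IsTightMatching (contractWeight w (contractCompl X)) μ ∧ μ p = q := by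
      intro p q hpq
      refine ih _ ?_ (hw.isCubicWeight_contractCompl hX hX3) hpq rfl
      simp only [Fintype.card_option, Fintype.card_coe]
      omega
    have ih2 : ∀ p q, 0 < contractWeight w (contractCompl Xᶜ) p q →
        ∃ μ, IsTightMatching (contractWeight w (contractCompl Xᶜ)) μ ∧ μ p = q := by
      intro p q hpq
      refine ih _ ?_ (hw.isCubicWeight_contractCompl hXc hXc3) hpq rfl
      simp only [Fintype.card_option, Fintype.card_coe]
      omega
    -- If `ab` itself crosses the cut, the outer end must be `b` and not an arbitrary outside
    -- neighbour of `u`.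
    have hside : ∃ u z, u ∈ X ∧ z ∉ X ∧ 0 < w u z ∧ (b ∉ X → u = a ∧ z = b) ∧ ∃ η : V → V,
      (∀ v ∈ X, v ≠ u → η v ∈ X ∧ η v ≠ u ∧ η (η v) = v ∧ 0 < w v (η v)) ∧
      (b ∈ X → a ≠ u ∧ η a = b) ∧
      ∀ Y ⊆ X, Odd Y.card → cutWeight w Y = 3 → #{v ∈ Y | v = u ∨ η v ∉ Y} = 1 := by
      obtain ⟨u, z, hu, hz, huz, h1, η, h2⟩ := hw.exists_side ih1 ha hab
      by_cases hb : b ∈ X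
      · exact ⟨u, z, hu, hz, huz, fun h => absurd hb h, η, h2⟩
      · obtain rfl := h1 hb
        exact ⟨u, b, hu, hb, hab, fun _ => ⟨rfl, rfl⟩, η, h2⟩
    obtain ⟨u, z, hu, hz, huz, hb1, η, hη1, hη2, hη3⟩ := hside
    have hz' : z ∈ Xᶜ := by simpa using hz
    -- The matching on the other side is requested through the crossing edge just found, so the two
    -- matchings agree on the cut.
    obtain ⟨z₀, -, -, -, -, hz₀, θ, hθ1, -, hθ3⟩ :=
      hw.exists_side ih2 hz' (q := u) (by rwa [hw.symm])
    obtain rfl := hz₀ (by simpa using hu)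
    clear hz₀
    let μ : V → V := fun v =>
      if v ∈ X then (if v = u then z₀ else η v) else if v = z₀ then u else θ v
    have hμu : μ u = z₀ := by simp [μ, hu]
    have hμz : μ z₀ = u := by simp [μ, hz]
    have hμX : ∀ v ∈ X, v ≠ u → μ v = η v := fun v h1 h2 => by simp [μ, h1, h2]
    have hμXc : ∀ v ∉ X, v ≠ z₀ → μ v = θ v := fun v h1 h2 => by simp [μ, h1, h2]
    refine ⟨μ, hw.isTightMatching_of_laminar hX hX3 ?_ ?_ ?_ ?_, ?_⟩
    · intro v
      by_cases hv : v ∈ X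
      · by_cases hvu : v = u
        · rw [hvu, hμu, hμz]
        · obtain ⟨h1, h2, h3, -⟩ := hη1 v hv hvu
          rw [hμX v hv hvu, hμX _ h1 h2, h3]
      · by_cases hvu : v = z₀
        · rw [hvu, hμz, hμu]
        · obtain ⟨h1, h2, h3, -⟩ := hθ1 v (by simpa using hv) hvu
          rw [hμXc v hv hvu, hμXc _ (by simpa using h1) h2, h3]
    · intro v
      by_cases hv : v ∈ X
      · by_cases hvu : v = u
        · rw [hvu, hμu]; exact huz
        · rw [hμX v hv hvu]
          exact (hη1 v hv hvu).2.2.2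
      · by_cases hvu : v = z₀
        · rw [hvu, hμz, hw.symm]; exact huz
        · rw [hμXc v hv hvu]
          exact (hθ1 v (by simpa using hv) hvu).2.2.2
    · intro Y hYX hY hY3
      rw [← hη3 Y hYX hY hY3]
      unfold crossing
      congr 1
      refine Finset.filter_congr fun v hv => ?_
      by_cases hvu : v = u
      · simp only [hvu, hμu, true_or, iff_true]
        exact fun h => hz (hYX h)
      · rw [hμX v (hYX hv) hvu]
        simp [hvu]
    · intro Y hYX hY hY3
      rw [← hθ3 Y hYX hY hY3]
      unfold crossing
      congr 1
      refine Finset.filter_congr fun v hv => ?_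
      by_cases hvu : v = z₀
      · simp only [hvu, hμz, true_or, iff_true]
        intro h
        have := hYX h
        simp [hu] at this
      · rw [hμXc v (by simpa using hYX hv) hvu]
        simp [hvu]
    · by_cases hb : b ∈ X
      · obtain ⟨h1, h2⟩ := hη2 hb
        rw [hμX a ha h1, h2]
      · obtain ⟨rfl, rfl⟩ := hb1 hb
        exact hμu
  -- Every tight odd cut now has a single vertex on one side, so any perfect matching meets it
  -- exactly once.
  · push Not at hX
    obtain ⟨μ, h1, h2, h3⟩ := hw.exists_involution_through hab
    refine ⟨μ, ⟨h1, h2, ?_⟩, h3⟩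
    have hμne : ∀ v, μ v ≠ v := by
      intro v hv
      have := h2 v
      rw [hv, hw.loopless] at this
      omega
    have hone : ∀ Y : Finset V, Y.card = 1 → crossing μ Y = 1 := by
      intro Y hY
      obtain ⟨v, rfl⟩ := Finset.card_eq_one.mp hY
      unfold crossing
      rw [Finset.filter_true_of_mem (by simpa using hμne v)]
      simp
    intro X hXodd hX3
    by_cases hX1 : X.card = 1
    · exact hone X hX1
    · rw [← crossing_compl h1]
      refine hone _ ?_
      have h4 := hX X hXodd hX3 (by grind)
      have := Finset.card_add_card_compl X
      have := hw.even_card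
      grind

/-! ### Orienting a 2-factor -/

section Orientation

/-- A finite 2-regular graph is the graph of a permutation without cycles of length at most two. -/
theorem SimpleGraph.exists_perm_of_two_regular {V : Type*} [Finite V] (F : SimpleGraph V)
    (h2 : ∀ v, ∃ x y, x ≠ y ∧ ∀ w, F.Adj v w ↔ w = x ∨ w = y) :
    ∃ σ : Equiv.Perm V, (∀ u v, F.Adj u v ↔ v = σ u ∨ u = σ v) ∧ ∀ u, σ (σ u) ≠ u := by
  classical
  have ho : ∀ u v, F.Adj u v → ∃ w, F.Adj v w ∧ w ≠ u ∧ ∀ w', F.Adj v w' → w' = u ∨ w' = w := by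
    intro u v huv
    obtain ⟨x, y, hxy, h⟩ := h2 v
    rcases (h u).mp huv.symm with rfl | rfl
    · exact ⟨y, (h y).mpr (Or.inr rfl), hxy.symm, fun w' hw' => (h w').mp hw'⟩
    · exact ⟨x, (h x).mpr (Or.inl rfl), hxy, fun w' hw' => ((h w').mp hw').symm⟩
  choose o ho1 ho2 ho3 using ho
  let D := {p : V × V // F.Adj p.1 p.2}
  let rev : D → D := fun d => ⟨(d.1.2, d.1.1), d.2.symm⟩
  -- Work on darts: `nxt` walks on without turning back, and reversing darts conjugates it to its
  -- inverse.
  let nxt : D → D := fun d => ⟨(d.1.2, o d.1.1 d.1.2 d.2), ho1 _ _ d.2⟩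
  have hrev : ∀ d, rev (rev d) = d := fun d => rfl
  have hrevne : ∀ d, rev d ≠ d := by
    intro d h
    have : d.1.2 = d.1.1 := congrArg (fun e : D => e.1.1) h
    exact d.2.ne this.symm
  have hnxt : ∀ d, nxt (rev (nxt d)) = rev d := by
    intro d
    refine Subtype.ext (Prod.ext rfl ?_)
    have := ho3 _ _ (rev (nxt d)).2 d.1.1 d.2.symm
    rcases this with h | h
    · exact absurd h.symm (ho2 _ _ d.2)
    · exact h.symm
  let N : Equiv.Perm D :=
    { toFun := nxt
      invFun := fun d => rev (nxt (rev d))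
      left_inv := fun d => by
        show rev (nxt (rev (nxt d))) = d
        rw [hnxt, hrev]
      right_inv := fun d => by
        show nxt (rev (nxt (rev d))) = d
        rw [hnxt, hrev] }
  have hN : ∀ d, N d = nxt d := fun d => rfl
  have hNrev : ∀ d, rev (N d) = N⁻¹ (rev d) := fun d => by
    rw [Equiv.Perm.eq_inv_iff_eq, hN, hN, hnxt]
  have hNinvrev : ∀ d, rev (N⁻¹ d) = N (rev d) := fun d => by
    have h1 : ∀ e, N (N⁻¹ e) = e := fun e => N.apply_symm_apply e
    have := hNrev (N⁻¹ d)
    rw [h1] at this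
    rw [this, h1]
  have hzpow : ∀ (k : ℤ) d, rev ((N ^ k) d) = (N ^ (-k)) (rev d) := by
    intro k
    induction k using Int.induction_on with
    | zero => intro d; simp
    | succ k ih =>
      intro d
      rw [add_comm, zpow_add, Equiv.Perm.mul_apply, zpow_one, hNrev, ih, neg_add, zpow_add,
        Equiv.Perm.mul_apply, zpow_neg_one]
    | pred k ih =>
      intro d
      rw [sub_eq_add_neg, add_comm, zpow_add, Equiv.Perm.mul_apply, zpow_neg_one, hNinvrev, ih,
        neg_add, zpow_add, Equiv.Perm.mul_apply, neg_neg, neg_neg, zpow_one]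
  -- If the walk from `d` reached its reverse, then halfway along, a dart would equal its own
  -- reverse (even length) or the walk would turn back (odd length).
  have hsc : ∀ d, ¬ N.SameCycle d (rev d) := by
    rintro d ⟨k, hk⟩
    obtain ⟨m, rfl | rfl⟩ := Int.even_or_odd' k
    · refine hrevne ((N ^ m) d) ?_
      rw [hzpow, ← hk, ← Equiv.Perm.mul_apply, ← zpow_add]
      congr 2
      ring
    · have : N ((N ^ m) d) = rev ((N ^ m) d) := by
        rw [hzpow, ← hk, ← Equiv.Perm.mul_apply, ← Equiv.Perm.mul_apply, ← zpow_add, ← zpow_one_add]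
        congr 2
        ring
      have h := congrArg (fun e : D => e.1.2) this
      exact ho2 _ _ _ h
  have : Finite (Quotient (Equiv.Perm.SameCycle.setoid N)) := inferInstance
  obtain ⟨n, ⟨e⟩⟩ := Finite.exists_equiv_fin (Quotient (Equiv.Perm.SameCycle.setoid N))
  let c : D → Fin n := fun d => e (Quotient.mk _ d)
  have hc : ∀ d d', c d = c d' ↔ N.SameCycle d d' := by
    intro d d'
    simp only [c, e.injective.eq_iff]
    exact Quotient.eq
  -- The two directions of a cycle are different dart orbits. An arbitrary linear order on the
  -- orbits chooses one of them.
  let P : D → Prop := fun d => c d < c (rev d)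
  have hPN : ∀ d, P (N d) ↔ P d := by
    intro d
    have h1 : c (N d) = c d := (hc _ _).mpr (Equiv.Perm.sameCycle_apply_left.mpr .rfl)
    have h3 : c (rev (N d)) = c (rev d) := by
      rw [hNrev]
      exact (hc _ _).mpr (by rw [Equiv.Perm.inv_def, Equiv.Perm.sameCycle_symm_apply_left])
    simp only [P, h1, h3]
  have hPrev : ∀ d, P (rev d) ↔ ¬ P d := by
    intro d
    have := fun h => hsc d ((hc _ _).mp h)
    simp only [P, hrev, not_lt]
    exact ⟨le_of_lt, fun h => lt_of_le_of_ne h fun h' => this h'.symm⟩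
  have hPnext : ∀ u v w (huv : F.Adj u v) (hvw : F.Adj v w), w ≠ u →
      (P ⟨(u, v), huv⟩ ↔ P ⟨(v, w), hvw⟩) := by
    intro u v w huv hvw hne
    have : N ⟨(u, v), huv⟩ = ⟨(v, w), hvw⟩ := by
      refine Subtype.ext (Prod.ext rfl ?_)
      exact ((ho3 _ _ huv w hvw).resolve_left hne).symm
    rw [← this, hPN]
  have hPsymm : ∀ u v (huv : F.Adj u v), P ⟨(v, u), huv.symm⟩ ↔ ¬ P ⟨(u, v), huv⟩ :=
    fun u v huv => hPrev ⟨(u, v), huv⟩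
  have hout : ∀ u, ∃ v, ∃ h : F.Adj u v, P ⟨(u, v), h⟩ := by
    intro u
    obtain ⟨x, y, hxy, h⟩ := h2 u
    have hx : F.Adj u x := (h x).mpr (Or.inl rfl)
    have hy : F.Adj u y := (h y).mpr (Or.inr rfl)
    by_cases hP : P ⟨(u, x), hx⟩
    · exact ⟨x, hx, hP⟩
    · exact ⟨y, hy, (hPnext x u y hx.symm hy hxy.symm).mp ((hPsymm u x hx).mpr hP)⟩
  choose s hs1 hs2 using hout
  have hinj : Function.Injective s := by
    intro u u' huu
    by_contra hne
    have h1 : F.Adj (s u) u' := by rw [huu]; exact (hs1 u').symm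
    have h3 := (hPnext u (s u) u' (hs1 u) h1 (fun h => hne h.symm)).mp (hs2 u)
    have h4 := (hPsymm u' (s u) h1.symm).mp h3
    have h5 := hs2 u'
    simp only [← huu] at h5
    exact h4 h5
  let σ : Equiv.Perm V := Equiv.ofBijective s (Finite.injective_iff_bijective.mp hinj)
  have hσ : ∀ u, σ u = s u := fun u => rfl
  refine ⟨σ, fun u v => ⟨fun huv => ?_, ?_⟩, fun u h => ?_⟩
  · have key : ∀ u v (huv : F.Adj u v), P ⟨(u, v), huv⟩ → v = σ u := by
      intro u v huv hP
      by_contra hne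
      rw [hσ] at hne
      have h3 := (hPnext (s u) u v (hs1 u).symm huv hne).mpr hP
      exact (hPsymm u (s u) (hs1 u)).mp h3 (hs2 u)
    by_cases hP : P ⟨(u, v), huv⟩
    · exact Or.inl (key u v huv hP)
    · exact Or.inr (key v u huv.symm ((hPsymm u v huv).mpr hP))
  · rintro (rfl | rfl)
    · exact hs1 u
    · exact (hs1 v).symm
  · rw [hσ, hσ] at h
    have h1 := hs2 (s u)
    simp only [h] at h1
    exact (hPsymm u (s u) (hs1 u)).mp h1 (hs2 u)

end Orientation

/-! ### From bridgeless cubic graphs to frames -/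

section Frame

variable {V : Type*}

/-- A permutation `σ` and an involution `μ` describing a 2-factor and the complementary perfect
matching of a cubic graph, such that the matching contains no odd cut with three edges. -/
structure IsFrame [DecidableEq V] (G : SimpleGraph V) (σ : Equiv.Perm V) (μ : V → V) : Prop where
  adj : ∀ u v, G.Adj u v ↔ v = σ u ∨ u = σ v ∨ v = μ u
  invol : ∀ v, μ (μ v) = v
  sq_ne : ∀ v, σ (σ v) ≠ v
  ne : ∀ v, σ v ≠ v
  mu_ne : ∀ v, μ v ≠ v
  mu_ne_apply : ∀ v, μ v ≠ σ v
  apply_mu_ne : ∀ v, σ (μ v) ≠ v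
  five_le : ∀ X : Finset V, Odd X.card → (∀ v, σ v ∈ X ↔ v ∈ X) → 5 ≤ crossing μ X

/-- The weights of a simple graph. -/
def adjWeight (G : SimpleGraph V) [DecidableRel G.Adj] (u v : V) : ℕ := if G.Adj u v then 1 else 0

variable [Fintype V] [DecidableEq V]

/-- The cut of an odd set is odd, and a cut consisting of one edge would be a bridge. -/
theorem isCubicWeight_adjWeight (G : SimpleGraph V) [DecidableRel G.Adj]
    (hcubic : G.IsRegularOfDegree 3) (hb : IsBridgeless G) : IsCubicWeight (adjWeight G) := by
  have hs : ∀ u v, adjWeight G u v = adjWeight G v u := by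
    intro u v
    simp only [adjWeight, G.adj_comm]
  have h0 : ∀ v, adjWeight G v v = 0 := fun v => by simp [adjWeight]
  have hd : ∀ v, ∑ u, adjWeight G v u = 3 := by
    intro v
    rw [← hcubic v]
    simp [adjWeight, ← SimpleGraph.card_neighborFinset_eq_degree,
      SimpleGraph.neighborFinset_eq_filter]
  refine ⟨hs, h0, hd, fun X hX => ?_⟩
  have hodd := (odd_cutWeight hs h0 hd X).mpr hX
  by_contra hlt
  have h1 : cutWeight (adjWeight G) X = 1 := by grind
  have h2 : cutWeight (adjWeight G) X =
      #{p : V × V | (p.1 ∈ X ∧ p.2 ∉ X) ∧ G.Adj p.1 p.2} := by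
    unfold cutWeight adjWeight
    rw [Finset.card_filter, ← Fintype.sum_prod_type']
    refine Finset.sum_congr rfl fun p _ => ?_
    by_cases h : p.1 ∈ X ∧ p.2 ∉ X <;> simp [h]
  rw [h2, Finset.card_eq_one] at h1
  obtain ⟨⟨u, v⟩, huv⟩ := h1
  have hmem : ∀ x y, x ∈ X → y ∉ X → G.Adj x y → x = u ∧ y = v := by
    intro x y hx hy hxy
    have : (x, y) ∈ ({p : V × V | (p.1 ∈ X ∧ p.2 ∉ X) ∧ G.Adj p.1 p.2} : Finset _) := by
      simp [hx, hy, hxy]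
    rw [huv] at this
    simpa using this
  have huv' : (u, v) ∈ ({p : V × V | (p.1 ∈ X ∧ p.2 ∉ X) ∧ G.Adj p.1 p.2} : Finset _) := by
    rw [huv]; simp
  simp only [Finset.mem_filter, Finset.mem_univ, true_and] at huv'
  refine hb s(u, v) huv'.2 ?_
  rw [SimpleGraph.isBridge_iff]
  rintro ⟨p⟩
  have key : ∀ x y, (G.deleteEdges {s(u, v)}).Walk x y → x ∈ X → y ∈ X := by
    intro x y p
    induction p with
    | nil => exact id
    | cons h p ih =>
      intro hx
      refine ih ?_
      by_contra hy
      rw [SimpleGraph.deleteEdges_adj] at h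
      obtain ⟨rfl, rfl⟩ := hmem _ _ hx hy h.1
      exact h.2 rfl
  exact huv'.1.2 (key _ _ p huv'.1.1)

theorem exists_isFrame [Nonempty V] (G : SimpleGraph V) [DecidableRel G.Adj]
    (hcubic : G.IsRegularOfDegree 3) (hb : IsBridgeless G) :
    ∃ σ μ, IsFrame G σ μ := by
  have hw := isCubicWeight_adjWeight G hcubic hb
  obtain ⟨a⟩ := ‹Nonempty V›
  obtain ⟨b, hab⟩ : ∃ b, G.Adj a b := by
    have := hcubic a
    rw [← G.degree_pos_iff_exists_adj]
    omega
  obtain ⟨μ, hμ, -⟩ := hw.exists_isTightMatching (a := a) (b := b) (by simp [adjWeight, hab])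
  have hadj : ∀ v, G.Adj v (μ v) := by
    intro v
    have := hμ.pos v
    by_contra h
    simp [adjWeight, h] at this
  let F : SimpleGraph V :=
    { Adj := fun u v => G.Adj u v ∧ v ≠ μ u
      symm := ⟨fun u v h => ⟨h.1.symm, fun h' => h.2 (by rw [h', hμ.invol])⟩⟩
      loopless := ⟨fun u h => G.loopless.irrefl u h.1⟩ }
  obtain ⟨σ, hσ1, hσ2⟩ := F.exists_perm_of_two_regular (by
    intro v
    have h1 : ((G.neighborFinset v).erase (μ v)).card = 2 := by
      rw [Finset.card_erase_of_mem (by simpa using hadj v), G.card_neighborFinset_eq_degree,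
        hcubic v]
    obtain ⟨x, y, hxy, h2⟩ := Finset.card_eq_two.mp h1
    refine ⟨x, y, hxy, fun w => ?_⟩
    have : w ∈ (G.neighborFinset v).erase (μ v) ↔ w ∈ ({x, y} : Finset V) := by rw [h2]
    simp only [Finset.mem_erase, SimpleGraph.mem_neighborFinset, Finset.mem_insert,
      Finset.mem_singleton] at this
    rw [← this]
    exact and_comm)
  have hF : ∀ u, F.Adj u (σ u) := fun u => (hσ1 _ _).mpr (Or.inl rfl)
  have hμσ : ∀ v, μ v ≠ σ v := fun v h => (hF v).2 h.symm
  refine ⟨σ, μ, ⟨fun u v => ?_, hμ.invol, hσ2, fun v => (hF v).ne', fun v => (hadj v).ne', hμσ,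
    fun v h => (hF (μ v)).2 (by rw [h, hμ.invol]), fun X hX hcl => ?_⟩⟩
  · by_cases h : v = μ u
    · simp [h, hadj]
    · rw [show G.Adj u v ↔ F.Adj u v from ⟨fun h' => ⟨h', h⟩, fun h' => h'.1⟩, hσ1]
      simp [h]
  -- As `X` is a union of cycles, all edges leaving it are matching edges. The cut is odd and at
  -- least 3; were it 3, the tight matching would cross it only once. So it is at least 5.
  · have h1 : crossing μ X = cutWeight (adjWeight G) X := by
      rw [crossing_eq_cutWeight]
      unfold cutWeight
      refine Finset.sum_congr rfl fun u _ => Finset.sum_congr rfl fun v _ => ?_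
      by_cases h2 : u ∈ X ∧ v ∉ X
      swap
      · rw [if_neg h2, if_neg h2]
      rw [if_pos h2, if_pos h2]
      by_cases h3 : v = μ u
      · subst h3; simp [adjWeight, hadj]
      · have h4 : ¬ G.Adj u v := by
          intro h5
          rcases (hσ1 u v).mp ⟨h5, h3⟩ with rfl | rfl
          · exact h2.2 ((hcl u).mpr h2.1)
          · exact h2.2 ((hcl v).mp h2.1)
        simp [adjWeight, h3, h4]
    have h2 := (odd_cutWeight hw.symm hw.loopless hw.degree X).mpr hX
    have h3 := hw.three_le X hX
    have h4 := hμ.tight X hX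
    grind

end Frame

/-! ### Medium edges and missing colours -/

section Medium

variable {V : Type*} {G : SimpleGraph V}

/-- Here `x` and `y` are the colours missing at the two ends. The colours seen by `e` are those
other than `f e` that are not missing at both ends: two of them if `x = y`, three otherwise. -/
theorem EdgeColouring.isMedium_iff_ne {f : EdgeColouring G 4} {e : G.edgeSet} {u v : V}
    (he : e.1 = s(u, v)) {x y : Fin 4}
    (hx : ∀ c, c ≠ x ↔ ∃ e' : G.edgeSet, u ∈ e'.1 ∧ f e' = c)
    (hy : ∀ c, c ≠ y ↔ ∃ e' : G.edgeSet, v ∈ e'.1 ∧ f e' = c) :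
    f.IsMedium e ↔ x ≠ y := by
  have hu : u ∈ e.1 := by simp [he]
  have hv : v ∈ e.1 := by simp [he]
  have hex : f e ≠ x := (hx _).mpr ⟨e, hu, rfl⟩
  have hey : f e ≠ y := (hy _).mpr ⟨e, hv, rfl⟩
  have hset : f.adjacentColours e =
      ↑({c | c ≠ f e ∧ (c ≠ x ∨ c ≠ y)} : Finset (Fin 4)) := by
    ext c
    simp only [EdgeColouring.adjacentColours, Set.mem_image, SimpleGraph.mem_neighborSet,
      Finset.coe_filter, Finset.mem_univ, true_and, Set.mem_ofPred_eq]
    constructor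
    · rintro ⟨e', he', rfl⟩
      refine ⟨fun h => f.valid he' h.symm, ?_⟩
      obtain ⟨-, z, hz, hz'⟩ := SimpleGraph.lineGraph_adj_iff_exists.mp he'
      rw [he, Sym2.mem_iff] at hz
      rcases hz with rfl | rfl
      · exact Or.inl ((hx _).mpr ⟨e', hz', rfl⟩)
      · exact Or.inr ((hy _).mpr ⟨e', hz', rfl⟩)
    · rintro ⟨hc, h | h⟩
      · obtain ⟨e', h1, rfl⟩ := (hx _).mp h
        exact ⟨e', SimpleGraph.lineGraph_adj_iff_exists.mpr
          ⟨fun h => hc (by rw [h]), u, hu, h1⟩, rfl⟩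
      · obtain ⟨e', h1, rfl⟩ := (hy _).mp h
        exact ⟨e', SimpleGraph.lineGraph_adj_iff_exists.mpr
          ⟨fun h => hc (by rw [h]), v, hv, h1⟩, rfl⟩
  unfold EdgeColouring.IsMedium EdgeColouring.IsRich EdgeColouring.IsPoor
  rw [hset, Set.ncard_coe_finset]
  generalize f e = z at hex hey
  clear hx hy hset
  revert x y z
  decide

end Medium

/-! ### Colouring the cycles -/

section OrbitColouring

variable {V : Type*}

/-- The orbits of a permutation. -/
abbrev PermOrbit (σ : Equiv.Perm V) : Type _ := Quotient (Equiv.Perm.SameCycle.setoid σ)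

/-- The orbit of a point. -/
def permOrbit (σ : Equiv.Perm V) (v : V) : PermOrbit σ := Quotient.mk _ v

theorem permOrbit_eq_iff {σ : Equiv.Perm V} {u v : V} :
    permOrbit σ u = permOrbit σ v ↔ σ.SameCycle u v := Quotient.eq

@[simp] theorem permOrbit_apply (σ : Equiv.Perm V) (v : V) : permOrbit σ (σ v) = permOrbit σ v :=
  permOrbit_eq_iff.mpr (Equiv.Perm.sameCycle_apply_left.mpr .rfl)

@[simp] theorem permOrbit_symm_apply (σ : Equiv.Perm V) (v : V) :
    permOrbit σ (σ.symm v) = permOrbit σ v :=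
  permOrbit_eq_iff.mpr (Equiv.Perm.sameCycle_symm_apply_left.mpr .rfl)

/-- The points of an orbit. -/
noncomputable def orbitFinset [Fintype V] (σ : Equiv.Perm V) (c : PermOrbit σ) : Finset V :=
  open Classical in {v | permOrbit σ v = c}

@[simp] theorem mem_orbitFinset [Fintype V] {σ : Equiv.Perm V} {c : PermOrbit σ} {v : V} :
    v ∈ orbitFinset σ c ↔ permOrbit σ v = c := by
  simp [orbitFinset]

/-- Distance along `σ` from a base point of each orbit. -/
theorem exists_orbit_dist [Fintype V] (σ : Equiv.Perm V) (s : PermOrbit σ → V)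
    (hs : ∀ c, permOrbit σ (s c) = c) :
    ∃ j : V → ℕ, (∀ v, j v = 0 ↔ v = s (permOrbit σ v)) ∧
      ∀ v, (σ v = s (permOrbit σ v) → j v + 1 = #(orbitFinset σ (permOrbit σ v))) ∧
        (σ v ≠ s (permOrbit σ v) → j (σ v) = j v + 1) := by
  classical
  have hex : ∀ v, ∃ i : ℕ, (σ ^ i) (s (permOrbit σ v)) = v := fun v =>
    (permOrbit_eq_iff.mp (hs (permOrbit σ v))).exists_nat_pow_eq
  let j : V → ℕ := fun v => Nat.find (hex v)
  have hj : ∀ v, (σ ^ j v) (s (permOrbit σ v)) = v := fun v => Nat.find_spec (hex v)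
  have hmin : ∀ v i, (σ ^ i) (s (permOrbit σ v)) = v → j v ≤ i := fun v i h => Nat.find_min' _ h
  have hj0 : ∀ v, j v = 0 ↔ v = s (permOrbit σ v) := by
    intro v
    constructor
    · intro h
      have := hj v
      rw [h] at this
      simpa using this.symm
    · intro h
      have := hmin v 0 (by simpa using h.symm)
      omega
  have hsucc : ∀ v, (σ ^ (j v + 1)) (s (permOrbit σ v)) = σ v := fun v => by
    rw [pow_succ', Equiv.Perm.mul_apply, hj]
  refine ⟨j, hj0, fun v => ⟨fun h => ?_, fun h => ?_⟩⟩
  · set x := s (permOrbit σ v) with hx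
    have hper : (σ ^ (j v + 1)) x = x := by rw [hsucc, h]
    rw [← Finset.card_range (j v + 1)]
    refine Finset.card_bij (fun i _ => (σ ^ i) x) ?_ ?_ ?_
    · intro i _
      rw [mem_orbitFinset, permOrbit_eq_iff, Equiv.Perm.sameCycle_pow_left, ← permOrbit_eq_iff]
      exact hs _
    · have key : ∀ i k, i < k → k ≤ j v → (σ ^ i) x ≠ (σ ^ k) x := by
        intro i k hik hkj heq
        have h1 : (σ ^ (j v - k + i)) x = v := by
          rw [pow_add, Equiv.Perm.mul_apply, heq, ← Equiv.Perm.mul_apply, ← pow_add]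
          rw [Nat.sub_add_cancel hkj, hx, hj]
        have := hmin v _ h1
        omega
      intro i hi k hk heq
      simp only [Finset.mem_range] at hi hk
      rcases lt_trichotomy i k with h1 | h1 | h1
      · exact absurd heq (key i k h1 (by omega))
      · exact h1
      · exact absurd heq.symm (key k i h1 (by omega))
    · intro u hu
      rw [mem_orbitFinset] at hu
      refine ⟨j u, ?_, ?_⟩
      · rw [Finset.mem_range]
        by_contra hlt
        have h1 : (σ ^ (j u - (j v + 1))) (s (permOrbit σ u)) = u := by
          conv_rhs => rw [← hj u]
          rw [hu, ← hx]
          conv_lhs => rw [← hper]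
          rw [← Equiv.Perm.mul_apply, ← pow_add]
          congr 2
          omega
        have := hmin u _ h1
        omega
      · rw [hx, ← hu, hj]
  · have h1 : j (σ v) ≤ j v + 1 := hmin _ _ (by rw [permOrbit_apply, hsucc])
    have h2 : j (σ v) ≠ 0 := by
      rw [Ne, hj0, permOrbit_apply]
      exact h
    have h3 : j v ≤ j (σ v) - 1 := by
      refine hmin _ _ ?_
      apply σ.injective
      rw [← Equiv.Perm.mul_apply, ← pow_succ', Nat.sub_add_cancel (by omega)]
      have := hj (σ v)
      rwa [permOrbit_apply] at this
    omega

/-- The chosen points `a c` and `b c` of the odd orbits `c`. -/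
def IsSpecial [Fintype V] (σ : Equiv.Perm V) (a b : PermOrbit σ → V) (v : V) : Prop :=
  Odd #(orbitFinset σ (permOrbit σ v)) ∧ (v = a (permOrbit σ v) ∨ v = b (permOrbit σ v))

open Classical in
/-- The colour missing at a vertex in the colouring determined by `a` and `b`. -/
noncomputable def specialColour [Fintype V] (σ : Equiv.Perm V) (a b : PermOrbit σ → V) (v : V) :
    Fin 4 :=
  if IsSpecial σ a b v then (if v = a (permOrbit σ v) then 0 else 1) else 2

/-- The value `g v` is the colour of the edge from `v` to `σ v`. Colour 3 is kept for the matching,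
so the last two inequalities identify the special colour as the one missing at `σ v`. -/
theorem exists_cycle_colouring [Fintype V] {σ : Equiv.Perm V} (hsq : ∀ v, σ (σ v) ≠ v)
    (hne : ∀ v, σ v ≠ v) {a b : PermOrbit σ → V} (ha : ∀ c, permOrbit σ (a c) = c)
    (hab : ∀ c, b c = σ (a c) ∨ a c = σ (b c)) :
    ∃ g : V → Fin 4, ∀ v, g v ≠ 3 ∧ g v ≠ g (σ v) ∧ specialColour σ a b (σ v) ≠ g v ∧
      specialColour σ a b (σ v) ≠ g (σ v) := by
  classical
  have hb : ∀ c, permOrbit σ (b c) = c := fun c => by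
    rcases hab c with h | h
    · rw [h, permOrbit_apply, ha]
    · rw [← permOrbit_apply, ← h, ha]
  -- The base point is whichever of `a c`, `b c` comes first along `σ`, so the edge leaving it joins
  -- the two.
  let s : PermOrbit σ → V := fun c => if b c = σ (a c) then a c else b c
  have hs : ∀ c, permOrbit σ (s c) = c := fun c => by
    simp only [s]; split_ifs
    · exact ha c
    · exact hb c
  obtain ⟨j, hj0, hj⟩ := exists_orbit_dist σ s hs
  let x : PermOrbit σ → Fin 4 := fun c => if b c = σ (a c) then 0 else 1
  let y : PermOrbit σ → Fin 4 := fun c => if b c = σ (a c) then 1 else 0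
  -- On an odd cycle the edge leaving the base point receives 2 and the others alternate from `x`,
  -- ending with `y`. So `x` is missing at the base point and `y` at its successor; `x` and `y` are
  -- arranged to make these 0 at `a c` and 1 at `b c`.
  let g : V → Fin 4 := fun v =>
    if Odd #(orbitFinset σ (permOrbit σ v)) ∧ j v = 0 then 2
    else if Odd (j v) then x (permOrbit σ v) else y (permOrbit σ v)
  refine ⟨g, fun v => ?_⟩
  have hm : specialColour σ a b (σ v) =
      if Odd #(orbitFinset σ (permOrbit σ v)) then
        if σ v = s (permOrbit σ v) then x (permOrbit σ v) else
        if v = s (permOrbit σ v) then y (permOrbit σ v) else 2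
      else 2 := by
    unfold specialColour IsSpecial
    rw [permOrbit_apply]
    by_cases ho : Odd #(orbitFinset σ (permOrbit σ v))
    swap
    · simp [ho]
    simp only [ho, true_and, if_true, x, y, s]
    rcases hab (permOrbit σ v) with h | h
    · simp only [h, if_true]
      by_cases h1 : σ v = a (permOrbit σ v)
      · simp [h1]
      · simp [h1]
    · have h' : b (permOrbit σ v) ≠ σ (a (permOrbit σ v)) := by
        intro h2
        rw [h] at h2
        exact hsq _ h2.symm
      simp only [h', if_false]
      rw [h]
      simp only [σ.injective.eq_iff]
      by_cases h1 : v = b (permOrbit σ v)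
      · simp [h1.symm, hne]
      · simp [h1]
  rw [hm]
  have hxy : ∀ c, x c ≠ y c ∧ x c ≠ 2 ∧ x c ≠ 3 ∧ y c ≠ 2 ∧ y c ≠ 3 := by
    intro c
    simp only [x, y]
    split_ifs <;> decide
  obtain ⟨h1, h2, h3, h4, h5⟩ := hxy (permOrbit σ v)
  obtain ⟨hw, hn⟩ := hj v
  have hv0 := hj0 v
  have hσ0 := hj0 (σ v)
  have hnev := hne v
  simp only [g, permOrbit_apply] at *
  generalize x (permOrbit σ v) = X at *
  generalize y (permOrbit σ v) = Y at *
  generalize s (permOrbit σ v) = S at *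
  generalize #(orbitFinset σ (permOrbit σ v)) = N at *
  have h32 : (2 : Fin 4) ≠ 3 := by decide
  by_cases hS : σ v = S
  · have hvS : v ≠ S := fun h => hnev (hS.trans h.symm)
    have e1 := hw hS
    have e2 := hσ0.mpr hS
    have e3 : j v ≠ 0 := fun h => hvS (hv0.mp h)
    by_cases hN : Odd N
    · have e4 : ¬ Odd (j v) := by grind
      simp [eq_true hS, hN, e3, e4, e2, h5, h4, h1, h2]
    · have e4 : Odd (j v) := by grind
      simp [hN, e4, e2, h3, h1, h2.symm, h4.symm]
  · have e1 := hn hS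
    by_cases hv : v = S
    · have e2 := hv0.mpr hv
      by_cases hN : Odd N
      · simp [hN, e1, e2, eq_true hv, hS, h2.symm, h1.symm, h4]
      · simp [hN, e1, e2, h1.symm, h5, h4.symm, h2.symm]
    · have e3 : j v ≠ 0 := fun h => hv (hv0.mp h)
      by_cases hN : Odd N
      · by_cases e4 : Odd (j v)
        · have e5 : ¬ Odd (j v + 1) := by grind
          simp [hS, hv, hN, e1, e3, e4, e5, h1, h3, h2.symm, h4.symm]
        · have e5 : Odd (j v + 1) := by grind
          simp [hS, hv, hN, e1, e3, e4, e5, h1.symm, h5, h2.symm, h4.symm]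
      · by_cases e4 : Odd (j v)
        · have e5 : ¬ Odd (j v + 1) := by grind
          simp [hN, e1, e4, e5, h1, h3, h2.symm, h4.symm]
        · have e5 : Odd (j v + 1) := by grind
          simp [hN, e1, e4, e5, h1.symm, h5, h2.symm, h4.symm]

end OrbitColouring

/-! ### Edge colourings from frames, and their medium edges -/

section FrameColouring

variable {V : Type*} [DecidableEq V] {G : SimpleGraph V} {σ : Equiv.Perm V} {μ : V → V}

theorem specialColour_ne_three [Fintype V] (a b : PermOrbit σ → V) (v : V) :
    specialColour σ a b v ≠ 3 := by
  unfold specialColour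
  split_ifs <;> decide

theorem specialColour_eq_two_iff [Fintype V] {a b : PermOrbit σ → V} {v : V} :
    specialColour σ a b v = 2 ↔ ¬ IsSpecial σ a b v := by
  unfold specialColour
  split_ifs with h1 h2 <;> simp [h1]

theorem IsFrame.sym2_apply_injective (hF : IsFrame G σ μ) {v w : V}
    (h : s(v, σ v) = s(w, σ w)) : v = w := by
  rcases Sym2.eq_iff.mp h with h | h
  · exact h.1
  · exact absurd (h.1 ▸ h.2) (hF.sq_ne w)

theorem IsFrame.sym2_mu_ne (hF : IsFrame G σ μ) (v w : V) : s(v, μ v) ≠ s(w, σ w) := by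
  intro h
  rcases Sym2.eq_iff.mp h with h | h
  · exact hF.mu_ne_apply v (h.2.trans (by rw [h.1]))
  · exact hF.apply_mu_ne v (by rw [h.2, ← h.1])

theorem IsFrame.edge_cases (hF : IsFrame G σ μ) {e : Sym2 V} (he : e ∈ G.edgeSet) :
    (∃ v, e = s(v, σ v)) ∨ ∃ v, e = s(v, μ v) := by
  induction e with
  | h u v =>
    rw [SimpleGraph.mem_edgeSet, hF.adj] at he
    rcases he with rfl | rfl | rfl
    · exact Or.inl ⟨u, rfl⟩
    · exact Or.inl ⟨v, Sym2.eq_swap⟩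
    · exact Or.inr ⟨u, rfl⟩

theorem IsFrame.edge_cases_of_mem (hF : IsFrame G σ μ) {e : Sym2 V} (he : e ∈ G.edgeSet) {u : V}
    (hu : u ∈ e) : e = s(u, σ u) ∨ e = s(σ.symm u, σ (σ.symm u)) ∨ e = s(u, μ u) := by
  rcases hF.edge_cases he with ⟨v, rfl⟩ | ⟨v, rfl⟩
  · rcases Sym2.mem_iff.mp hu with rfl | rfl
    · exact Or.inl rfl
    · exact Or.inr (Or.inl (by simp))
  · rcases Sym2.mem_iff.mp hu with rfl | rfl
    · exact Or.inr (Or.inr rfl)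
    · exact Or.inr (Or.inr (by rw [hF.invol, Sym2.eq_swap]))

variable [Fintype V]

/-- A proper colouring of the 2-factor extends to an edge colouring with the matching edges in the
remaining colour, and the missing colours determine the medium edges. -/
theorem IsFrame.exists_edgeColouring (hF : IsFrame G σ μ) {g m : V → Fin 4}
    (hg3 : ∀ v, g v ≠ 3) (hg : ∀ v, g v ≠ g (σ v)) (hm3 : ∀ v, m v ≠ 3)
    (hm : ∀ v, m (σ v) ≠ g v ∧ m (σ v) ≠ g (σ v)) :
    ∃ f : EdgeColouring G 4, ∀ (e : G.edgeSet) (u v : V), e.1 = s(u, v) →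
      (f.IsMedium e ↔ m u ≠ m v) := by
  classical
  let col : G.edgeSet → Fin 4 := fun e => if h : ∃ v, e.1 = s(v, σ v) then g h.choose else 3
  have hcolσ : ∀ e v, e.1 = s(v, σ v) → col e = g v := by
    intro e v h
    have hex : ∃ v, e.1 = s(v, σ v) := ⟨v, h⟩
    simp only [col, dif_pos hex]
    rw [hF.sym2_apply_injective (hex.choose_spec.symm.trans h)]
  have hcolμ : ∀ e v, e.1 = s(v, μ v) → col e = 3 := by
    intro e v h
    simp only [col]
    rw [dif_neg]
    rintro ⟨w, hw⟩
    exact hF.sym2_mu_ne v w (h.symm.trans hw)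
  have hsymm : ∀ v, g (σ.symm v) ≠ g v := fun v => by
    have := hg (σ.symm v)
    rwa [Equiv.apply_symm_apply] at this
  let f : EdgeColouring G 4 := SimpleGraph.Coloring.mk col (by
    intro e e' h heq
    obtain ⟨hne, u, hu, hu'⟩ := SimpleGraph.lineGraph_adj_iff_exists.mp h
    have key : ∀ e : G.edgeSet, u ∈ e.1 → (e.1 = s(u, σ u) ∧ col e = g u) ∨
        (e.1 = s(σ.symm u, σ (σ.symm u)) ∧ col e = g (σ.symm u)) ∨
        (e.1 = s(u, μ u) ∧ col e = 3) := by
      intro e hu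
      rcases hF.edge_cases_of_mem e.2 hu with h | h | h
      · exact Or.inl ⟨h, hcolσ e _ h⟩
      · exact Or.inr (Or.inl ⟨h, hcolσ e _ h⟩)
      · exact Or.inr (Or.inr ⟨h, hcolμ e _ h⟩)
    have h1 := hsymm u
    have h2 := hg3 u
    have h3 := hg3 (σ.symm u)
    rcases key e hu with ⟨k1, k2⟩ | ⟨k1, k2⟩ | ⟨k1, k2⟩ <;>
      rcases key e' hu' with ⟨k3, k4⟩ | ⟨k3, k4⟩ | ⟨k3, k4⟩ <;>
      first
      | exact hne (Subtype.ext (k1.trans k3.symm))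
      | grind)
  have hf : ∀ e, f e = col e := fun e => rfl
  have hmiss : ∀ u c, c ≠ m u ↔ ∃ e' : G.edgeSet, u ∈ e'.1 ∧ f e' = c := by
    intro u c
    have h1 : m u ≠ g (σ.symm u) ∧ m u ≠ g u := by
      have := hm (σ.symm u)
      rwa [Equiv.apply_symm_apply] at this
    have h2 : c ≠ m u ↔ c = g u ∨ c = g (σ.symm u) ∨ c = 3 := by
      have h3 := hsymm u
      have h4 := hg3 u
      have h5 := hg3 (σ.symm u)
      have h6 := hm3 u
      generalize g u = p at *
      generalize g (σ.symm u) = q at *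
      generalize m u = r at *
      clear * - h1 h3 h4 h5 h6
      revert c p q r
      decide
    rw [h2]
    constructor
    · rintro (rfl | rfl | rfl)
      · exact ⟨⟨s(u, σ u), (hF.adj _ _).mpr (Or.inl rfl)⟩, by simp, hcolσ _ _ rfl⟩
      · exact ⟨⟨s(σ.symm u, σ (σ.symm u)), (hF.adj _ _).mpr (Or.inl rfl)⟩, by simp, hcolσ _ _ rfl⟩
      · exact ⟨⟨s(u, μ u), (hF.adj _ _).mpr (Or.inr (Or.inr rfl))⟩, by simp, hcolμ _ _ rfl⟩
    · rintro ⟨e, hu, rfl⟩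
      rcases hF.edge_cases_of_mem e.2 hu with h | h | h
      · exact Or.inl (hcolσ e _ h)
      · exact Or.inr (Or.inl (hcolσ e _ h))
      · exact Or.inr (Or.inr (hcolμ e _ h))
  exact ⟨f, fun e u v he => EdgeColouring.isMedium_iff_ne he (hmiss u) (hmiss v)⟩

/-- A cycle edge is counted once, from its tail, but a matching edge from both ends; doubling the
bound makes this uniform. -/
theorem IsFrame.two_mul_numMedium_le (hF : IsFrame G σ μ) {m : V → Fin 4} {f : EdgeColouring G 4}
    (hf : ∀ (e : G.edgeSet) (u v : V), e.1 = s(u, v) → (f.IsMedium e ↔ m u ≠ m v)) :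
    2 * f.numMedium ≤ 2 * #{v | m v ≠ m (σ v)} + #{v | m v ≠ m (μ v)} := by
  classical
  have h1 : f.numMedium = (Subtype.val '' {e : G.edgeSet | f.IsMedium e}).ncard := by
    rw [Set.ncard_image_of_injective _ Subtype.val_injective]
    rfl
  have h2 : Subtype.val '' {e : G.edgeSet | f.IsMedium e} ⊆
      ↑(({v | m v ≠ m (σ v)} : Finset V).image (fun v => s(v, σ v)) ∪
        ({v | m v ≠ m (μ v)} : Finset V).image (fun v => s(v, μ v))) := by
    rintro _ ⟨e, he, rfl⟩
    simp only [Finset.coe_union, Finset.coe_image, Set.mem_union, Set.mem_image,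
      Finset.coe_filter, Finset.mem_univ, true_and, Set.mem_ofPred_eq]
    rcases hF.edge_cases e.2 with ⟨v, h⟩ | ⟨v, h⟩
    · exact Or.inl ⟨v, (hf e _ _ h).mp he, h.symm⟩
    · exact Or.inr ⟨v, (hf e _ _ h).mp he, h.symm⟩
  have h3 := Set.ncard_le_ncard h2 (Finset.finite_toSet _)
  rw [Set.ncard_coe_finset] at h3
  have h4 := h3.trans (Finset.card_union_le _ _)
  have h5 := Finset.card_image_le (s := ({v | m v ≠ m (σ v)} : Finset V))
    (f := fun v => s(v, σ v))
  have h6 := Finset.mul_card_image_le_card_of_maps_to (s := ({v | m v ≠ m (μ v)} : Finset V))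
    (t := ({v | m v ≠ m (μ v)} : Finset V).image (fun v => s(v, μ v))) (f := fun v => s(v, μ v))
    (fun v hv => Finset.mem_image_of_mem _ hv) 2 (by
      intro e he
      obtain ⟨v, hv, rfl⟩ := Finset.mem_image.mp he
      rw [← Finset.card_pair (hF.mu_ne v).symm]
      refine Finset.card_le_card ?_
      intro u hu
      simp only [Finset.mem_filter, Finset.mem_univ, true_and] at hv ⊢
      rcases Finset.mem_insert.mp hu with rfl | hu
      · exact ⟨hv, rfl⟩
      · rw [Finset.mem_singleton.mp hu, hF.invol]
        exact ⟨hv.symm, Sym2.eq_swap⟩)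
  omega

/-- The orbits of odd length. -/
noncomputable def oddOrbits (σ : Equiv.Perm V) : Finset (PermOrbit σ) :=
  open Classical in {c ∈ Finset.univ.image (permOrbit σ) | Odd #(orbitFinset σ c)}

theorem mem_oddOrbits {c : PermOrbit σ} : c ∈ oddOrbits σ ↔ Odd #(orbitFinset σ c) := by
  simp only [oddOrbits, Finset.mem_filter, Finset.mem_image, Finset.mem_univ, true_and,
    and_iff_right_iff_imp]
  intro _
  obtain ⟨v, rfl⟩ := Quotient.exists_rep c
  exact ⟨v, rfl⟩

open Classical in
/-- The colouring determined by adjacent vertices `a c`, `b c` on the cycles `c`. -/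
theorem IsFrame.exists_special_colouring (hF : IsFrame G σ μ) {a b : PermOrbit σ → V}
    (ha : ∀ c, permOrbit σ (a c) = c) (hab : ∀ c, b c = σ (a c) ∨ a c = σ (b c)) :
    ∃ f : EdgeColouring G 4, 2 * f.numMedium +
      #{v | IsSpecial σ a b v ∧ IsSpecial σ a b (μ v)} +
      #{v | (IsSpecial σ a b v ∧ IsSpecial σ a b (μ v)) ∧
        specialColour σ a b v = specialColour σ a b (μ v)} ≤ 10 * #(oddOrbits σ) := by
  obtain ⟨g, hg⟩ := exists_cycle_colouring hF.sq_ne hF.ne ha hab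
  obtain ⟨f, hf⟩ := hF.exists_edgeColouring (fun v => (hg v).1) (fun v => (hg v).2.1)
    (specialColour_ne_three a b) (fun v => (hg v).2.2)
  refine ⟨f, ?_⟩
  have h1 := hF.two_mul_numMedium_le hf
  have hmiff : ∀ v w, specialColour σ a b v ≠ specialColour σ a b w →
      IsSpecial σ a b v ∨ IsSpecial σ a b w := by
    intro v w h
    by_contra hc
    push Not at hc
    exact h ((specialColour_eq_two_iff.mpr hc.1).trans (specialColour_eq_two_iff.mpr hc.2).symm)
  -- On an odd cycle the missing colour can change only on the edge between the two special vertices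
  -- and the two cycle edges next to it.
  have h2 : #{v | specialColour σ a b v ≠ specialColour σ a b (σ v)} ≤ #(oddOrbits σ) * 3 := by
    refine (Finset.card_le_card (t := (oddOrbits σ).biUnion fun c =>
      if b c = σ (a c) then {σ.symm (a c), a c, b c} else {σ.symm (b c), b c, a c}) ?_).trans
      (Finset.card_biUnion_le_card_mul _ _ _ fun c _ => ?_)
    · intro v hv
      simp only [Finset.mem_filter, Finset.mem_univ, true_and] at hv
      have hor := hmiff _ _ hv
      unfold IsSpecial at hor
      rw [permOrbit_apply] at hor
      have hodd : Odd #(orbitFinset σ (permOrbit σ v)) := by tauto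
      rw [Finset.mem_biUnion]
      refine ⟨permOrbit σ v, mem_oddOrbits.mpr hodd, ?_⟩
      have hsym : ∀ w, σ v = w → v = σ.symm w := fun w h => by rw [← h, Equiv.symm_apply_apply]
      have hinj : ∀ w, σ v = σ w → v = w := fun w h => σ.injective h
      rcases hab (permOrbit σ v) with h | h
      · rw [if_pos h]
        simp only [Finset.mem_insert, Finset.mem_singleton]
        rcases hor with ⟨-, h' | h'⟩ | ⟨-, h' | h'⟩
        · tauto
        · tauto
        · exact Or.inl (hsym _ h')
        · exact Or.inr (Or.inl (hinj _ (h'.trans h)))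
      · rw [if_neg (fun h' => hF.sq_ne (b (permOrbit σ v)) (by rw [← h]; exact h'.symm))]
        simp only [Finset.mem_insert, Finset.mem_singleton]
        rcases hor with ⟨-, h' | h'⟩ | ⟨-, h' | h'⟩
        · tauto
        · tauto
        · exact Or.inr (Or.inl (hinj _ (h'.trans h)))
        · exact Or.inl (hsym _ h')
    · split_ifs <;> exact Finset.card_le_three
  set Sp : Finset V := {v | IsSpecial σ a b v} with hSp
  have hSpmem : ∀ v, v ∈ Sp ↔ IsSpecial σ a b v := fun v => by simp [hSp]
  have h3 : #Sp ≤ #(oddOrbits σ) * 2 := by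
    refine (Finset.card_le_card (t := (oddOrbits σ).biUnion fun c => {a c, b c}) ?_).trans
      (Finset.card_biUnion_le_card_mul _ _ _ fun c _ => Finset.card_le_two)
    intro v hv
    obtain ⟨hodd, hv⟩ := (hSpmem v).mp hv
    rw [Finset.mem_biUnion]
    exact ⟨permOrbit σ v, mem_oddOrbits.mpr hodd, by simpa using hv⟩
  have hinj : Function.Injective μ := (show Function.Involutive μ from hF.invol).injective
  have hmemim : ∀ v, v ∈ Sp.image μ ↔ IsSpecial σ a b (μ v) := fun v => by
    rw [Finset.mem_image]
    constructor
    · rintro ⟨w, hw, rfl⟩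
      rw [hF.invol]
      exact (hSpmem w).mp hw
    · intro h
      exact ⟨μ v, (hSpmem _).mpr h, hF.invol v⟩
  have h4 := Finset.card_union_add_card_inter Sp (Sp.image μ)
  rw [Finset.card_image_of_injective _ hinj] at h4
  have h5 : Sp ∩ Sp.image μ =
      ({v | IsSpecial σ a b v ∧ IsSpecial σ a b (μ v)} : Finset V) := by
    ext v
    rw [Finset.mem_inter, hmemim, hSpmem]
    simp
  rw [h5] at h4
  -- A medium matching edge has a special end. Special vertices matched to each other make `Sp` and
  -- its image overlap, and those of equal colour are moreover not medium.
  have h6 : #{v | specialColour σ a b v ≠ specialColour σ a b (μ v)} +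
      #{v | (IsSpecial σ a b v ∧ IsSpecial σ a b (μ v)) ∧
        specialColour σ a b v = specialColour σ a b (μ v)} ≤ #(Sp ∪ Sp.image μ) := by
    rw [← Finset.card_union_of_disjoint]
    · refine Finset.card_le_card fun v hv => ?_
      rw [Finset.mem_union, hmemim, hSpmem]
      simp only [Finset.mem_union, Finset.mem_filter, Finset.mem_univ, true_and] at hv
      rcases hv with hv | hv
      · exact hmiff _ _ hv
      · exact Or.inl hv.1.1
    · rw [Finset.disjoint_left]
      intro v hv hv'
      simp only [Finset.mem_filter, Finset.mem_univ, true_and] at hv hv'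
      exact hv hv'.2
  omega

end FrameColouring

/-! ### Matching the odd cycles and the upper bound -/

section OrbitMatching

variable {V : Type*} [Fintype V] [DecidableEq V] {G : SimpleGraph V} {σ : Equiv.Perm V} {μ : V → V}

/-- The points lying on a set of orbits. -/
noncomputable def orbitUnion (σ : Equiv.Perm V) (C : Finset (PermOrbit σ)) : Finset V :=
  open Classical in {v | permOrbit σ v ∈ C}

@[simp] theorem mem_orbitUnion {C : Finset (PermOrbit σ)} {v : V} :
    v ∈ orbitUnion σ C ↔ permOrbit σ v ∈ C := by
  simp [orbitUnion]

theorem card_orbitUnion (C : Finset (PermOrbit σ)) :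
    #(orbitUnion σ C) = ∑ c ∈ C, #(orbitFinset σ c) := by
  classical
  rw [Finset.card_eq_sum_card_fiberwise (f := permOrbit σ) (t := C) (fun v hv => by simpa using hv)]
  refine Finset.sum_congr rfl fun c hc => ?_
  congr 1
  ext v
  simp only [Finset.mem_filter, mem_orbitUnion, mem_orbitFinset, and_iff_right_iff_imp]
  rintro rfl
  exact hc

theorem odd_card_orbitUnion {C : Finset (PermOrbit σ)} (hC : C ⊆ oddOrbits σ) :
    Odd #(orbitUnion σ C) ↔ Odd #C := by
  classical
  rw [card_orbitUnion, Finset.odd_sum_iff_odd_card_odd]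
  rw [Finset.filter_true_of_mem fun c hc => mem_oddOrbits.mp (hC hc)]

theorem crossing_le_card (μ : V → V) (X : Finset V) : crossing μ X ≤ #X := Finset.card_filter_le _ _

theorem IsFrame.five_le_card_orbit (hF : IsFrame G σ μ) {c : PermOrbit σ} (hc : c ∈ oddOrbits σ) :
    5 ≤ #(orbitFinset σ c) :=
  (hF.five_le _ (mem_oddOrbits.mp hc) (fun v => by simp)).trans (crossing_le_card _ _)

theorem IsFrame.five_mul_card_le (hF : IsFrame G σ μ) {C : Finset (PermOrbit σ)}
    (hC : C ⊆ oddOrbits σ) : 5 * #C ≤ #(orbitUnion σ C) := by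
  rw [card_orbitUnion, mul_comm, ← smul_eq_mul, ← Finset.sum_const]
  exact Finset.sum_le_sum fun c hc => hF.five_le_card_orbit (hC hc)

theorem IsFrame.even_card (hF : IsFrame G σ μ) : Even (Fintype.card V) := by
  rw [← Nat.not_odd_iff_even]
  intro h
  have := hF.five_le Finset.univ (by rwa [Finset.card_univ]) (by simp)
  simp [crossing] at this

theorem IsFrame.even_card_oddOrbits (hF : IsFrame G σ μ) : Even #(oddOrbits σ) := by
  rw [← Nat.not_odd_iff_even, ← odd_card_orbitUnion subset_rfl]
  intro h
  have := Finset.card_add_card_compl (orbitUnion σ (oddOrbits σ))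
  have h1 : Even #(orbitUnion σ (oddOrbits σ))ᶜ := by
    classical
    have h2 : (orbitUnion σ (oddOrbits σ))ᶜ =
        orbitUnion σ (Finset.univ.image (permOrbit σ) \ oddOrbits σ) := by
      ext v
      simp
    rw [h2, card_orbitUnion, ← Nat.not_odd_iff_even, Finset.odd_sum_iff_odd_card_odd,
      Finset.filter_false_of_mem]
    · simp
    · intro c hc
      rw [← mem_oddOrbits]
      exact (Finset.mem_sdiff.mp hc).2
  have h2 := hF.even_card
  grind

/-- The deficiency form of Tutte's theorem: the `d` extra vertices, joined to everything, absorb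
unmatched odd cycles. In a violator each odd component has five matching edges leaving it, and their
other ends avoid all odd cycles not in `S`; there are too few such vertices. -/
theorem IsFrame.exists_orbit_matching (hF : IsFrame G σ μ) {d : ℕ} (hd : Even d)
    (hcard : Fintype.card V < 5 * #(oddOrbits σ) + 5 * d + 10) :
    ∃ ν : {c // c ∈ oddOrbits σ} ⊕ Fin d → {c // c ∈ oddOrbits σ} ⊕ Fin d,
      (∀ x, ν (ν x) = x) ∧ ∀ c c', ν (Sum.inl c) = Sum.inl c' → c ≠ c' ∧
        ∃ v, permOrbit σ v = c.1 ∧ permOrbit σ (μ v) = c'.1 := by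
  classical
  let H : SimpleGraph ({c // c ∈ oddOrbits σ} ⊕ Fin d) :=
    { Adj := fun x y => x ≠ y ∧ ∀ c c', x = Sum.inl c → y = Sum.inl c' →
        ∃ v, permOrbit σ v = c.1 ∧ permOrbit σ (μ v) = c'.1
      symm := ⟨fun x y h => ⟨h.1.symm, fun c c' h1 h2 => by
        obtain ⟨v, hv1, hv2⟩ := h.2 c' c h2 h1
        exact ⟨μ v, hv2, by rw [hF.invol, hv1]⟩⟩⟩
      loopless := ⟨fun x h => h.1 rfl⟩ }
  rcases H.exists_involution_or_odd_sets with ⟨ν, h1, h2⟩ | ⟨S, Q, hlt, hpar, hodd, hS, hQ, hcl⟩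
  · refine ⟨ν, h1, fun c c' h => ?_⟩
    have h3 := h2 (Sum.inl c)
    rw [h] at h3
    exact ⟨fun h4 => h3.1 (by rw [h4]), h3.2 c c' rfl rfl⟩
  exfalso
  have hQS : #S + 2 ≤ #Q := by
    have h1 := hF.even_card_oddOrbits
    simp only [Fintype.card_sum, Fintype.card_coe, Fintype.card_fin] at hpar
    grind
  -- A universal vertex outside `S` would lie in every member of `Q`, but these are disjoint and
  -- there are at least two.
  have hright : ∀ z : Fin d, Sum.inr z ∈ S := by
    intro z
    by_contra hz
    have hall : ∀ B ∈ Q, Sum.inr z ∈ B := by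
      intro B hB
      by_contra hzB
      obtain ⟨u, hu⟩ := Finset.card_pos.mp (hodd B hB).pos
      refine hz (hcl B hB u hu _ ⟨fun h => hzB (h ▸ hu), ?_⟩ hzB)
      intro _ _ _ h
      cases h
    obtain ⟨B, hB, B', hB', hne⟩ := Finset.one_lt_card.mp (show 1 < #Q by omega)
    exact Finset.disjoint_left.mp (hQ B hB B' hB' hne) (hall B hB) (hall B' hB')
  let O : Finset ({c // c ∈ oddOrbits σ} ⊕ Fin d) → Finset (PermOrbit σ) :=
    fun B => B.toLeft.map (Function.Embedding.subtype _)
  have hOmem : ∀ B c, c ∈ O B ↔ ∃ h : c ∈ oddOrbits σ, Sum.inl ⟨c, h⟩ ∈ B := by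
    intro B c
    simp [O]
  have hOsub : ∀ B, O B ⊆ oddOrbits σ := fun B c hc => ((hOmem B c).mp hc).1
  have hScard : #S = #(O S) + d := by
    rw [← Finset.card_toLeft_add_card_toRight (u := S), Finset.card_map]
    have : S.toRight = Finset.univ := by
      ext z
      simp [hright]
    rw [this, Finset.card_univ, Fintype.card_fin]
  have hQcard : ∀ B ∈ Q, Odd #(O B) := by
    intro B hB
    have h1 := Finset.card_toLeft_add_card_toRight (u := B)
    have h2 : B.toRight = ∅ := by
      ext z
      simp only [Finset.mem_toRight, Finset.notMem_empty, iff_false]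
      exact fun h => Finset.disjoint_left.mp (hS B hB) h (hright z)
    rw [h2, Finset.card_empty] at h1
    rw [Finset.card_map, show #B.toLeft = #B from h1]
    exact hodd B hB
  let X : Finset ({c // c ∈ oddOrbits σ} ⊕ Fin d) → Finset V := fun B => orbitUnion σ (O B)
  let Y : Finset ({c // c ∈ oddOrbits σ} ⊕ Fin d) → Finset V := fun B => {v ∈ X B | μ v ∉ X B}
  have hY5 : ∀ B ∈ Q, 5 ≤ #(Y B) := fun B hB =>
    hF.five_le _ ((odd_card_orbitUnion (hOsub B)).mpr (hQcard B hB)) (fun v => by simp [X])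
  have hYdisj : ∀ B ∈ Q, ∀ B' ∈ Q, B ≠ B' → Disjoint (Y B) (Y B') := by
    intro B hB B' hB' hne
    rw [Finset.disjoint_left]
    intro v hv hv'
    have h1 := (Finset.mem_filter.mp hv).1
    have h2 := (Finset.mem_filter.mp hv').1
    rw [mem_orbitUnion, hOmem] at h1 h2
    obtain ⟨h3, h4⟩ := h1
    obtain ⟨_, h5⟩ := h2
    exact Finset.disjoint_left.mp (hQ B hB B' hB' hne) h4 h5
  have hinj : Function.Injective μ := (show Function.Involutive μ from hF.invol).injective
  have hsub : (Q.biUnion Y).image μ ⊆ (orbitUnion σ (oddOrbits σ \ O S))ᶜ := by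
    intro w hw
    obtain ⟨v, hv, rfl⟩ := Finset.mem_image.mp hw
    obtain ⟨B, hB, hv⟩ := Finset.mem_biUnion.mp hv
    obtain ⟨h1, h2⟩ := Finset.mem_filter.mp hv
    rw [mem_orbitUnion, hOmem] at h1 h2
    rw [Finset.mem_compl, mem_orbitUnion, Finset.mem_sdiff, hOmem]
    rintro ⟨h3, h4⟩
    obtain ⟨h5, h6⟩ := h1
    refine h4 ⟨h3, hcl B hB _ h6 _ ⟨?_, ?_⟩ fun h => h2 ⟨h3, h⟩⟩
    · intro h
      exact h2 ⟨h3, h ▸ h6⟩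
    · intro c c' hc hc'
      refine ⟨v, ?_, ?_⟩
      · rw [← Sum.inl_injective hc]
      · rw [← Sum.inl_injective hc']
  have h1 := Finset.card_le_card hsub
  -- The count is `5 * #Q ≤ n - 5 * (k - #(O S))`, whereas `#Q ≥ #(O S) + d + 2`, with `n` vertices
  -- and `k` odd cycles.
  rw [Finset.card_image_of_injective _ hinj, Finset.card_biUnion hYdisj, Finset.card_compl] at h1
  have h2 : #Q * 5 ≤ ∑ B ∈ Q, #(Y B) := by
    rw [← smul_eq_mul, ← Finset.sum_const]
    exact Finset.sum_le_sum hY5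
  have h3 := hF.five_mul_card_le (C := oddOrbits σ \ O S) Finset.sdiff_subset
  have h4 := Finset.card_sdiff_add_card_eq_card (hOsub S)
  have h5 := Finset.card_le_univ (orbitUnion σ (oddOrbits σ \ O S))
  omega

/-- Representatives of the orbits, matched by `μ` for all but `d` of the odd orbits. -/
theorem IsFrame.exists_selection (hF : IsFrame G σ μ) {d : ℕ} (hd : Even d)
    (hcard : Fintype.card V < 5 * #(oddOrbits σ) + 5 * d + 10) :
    ∃ (a : PermOrbit σ → V) (M : Finset (PermOrbit σ)), (∀ c, permOrbit σ (a c) = c) ∧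
      M ⊆ oddOrbits σ ∧ #(oddOrbits σ) ≤ #M + d ∧
      ∀ c ∈ M, permOrbit σ (μ (a c)) ∈ M ∧ permOrbit σ (μ (a c)) ≠ c ∧
        a (permOrbit σ (μ (a c))) = μ (a c) := by
  classical
  obtain ⟨ν, hν, hν'⟩ := hF.exists_orbit_matching hd hcard
  choose hne x hx1 hx2 using hν'
  -- Two matched cycles may be joined by several edges. An arbitrary order decides whose choice is
  -- used, so that both representatives are ends of one edge.
  let e := Fintype.equivFin {c // c ∈ oddOrbits σ}
  have hsymm : ∀ c c', ν (Sum.inl c) = Sum.inl c' → ν (Sum.inl c') = Sum.inl c :=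
    fun c c' h => by rw [← h, hν]
  have ha : ∀ c : PermOrbit σ, ∃ v, permOrbit σ v = c ∧ ∀ (h : c ∈ oddOrbits σ) c'
      (hc : ν (Sum.inl ⟨c, h⟩) = Sum.inl c'), v = if e ⟨c, h⟩ < e c' then x ⟨c, h⟩ c' hc
        else μ (x c' ⟨c, h⟩ (hsymm _ _ hc)) := by
    intro c
    by_cases h : ∃ (h : c ∈ oddOrbits σ) (c' : _), ν (Sum.inl ⟨c, h⟩) = Sum.inl c'
    · obtain ⟨h, c', hc⟩ := h
      refine ⟨if e ⟨c, h⟩ < e c' then x ⟨c, h⟩ c' hc else μ (x c' ⟨c, h⟩ (hsymm _ _ hc)), ?_, ?_⟩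
      · split_ifs
        · exact hx1 _ _ _
        · exact hx2 c' ⟨c, h⟩ (hsymm _ _ hc)
      · intro _ c'' hc''
        obtain rfl : c' = c'' := Sum.inl_injective (hc.symm.trans hc'')
        rfl
    · obtain ⟨v, hv⟩ := Quotient.exists_rep c
      exact ⟨v, hv, fun h' c' hc => absurd ⟨h', c', hc⟩ h⟩
  choose a ha1 ha2 using ha
  have hcompat : ∀ c c', ν (Sum.inl c) = Sum.inl c' → μ (a c.1) = a c'.1 := by
    intro c c' h
    rw [ha2 c.1 c.2 c' h, ha2 c'.1 c'.2 c (hsymm _ _ h)]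
    have h1 : e c ≠ e c' := fun h' => hne c c' h (e.injective h')
    rcases lt_or_gt_of_ne h1 with h2 | h2
    · simp [h2, h2.not_gt]
    · simp [h2, h2.not_gt, hF.invol]
  let M' : Finset {c // c ∈ oddOrbits σ} := {c | ∃ c', ν (Sum.inl c) = Sum.inl c'}
  refine ⟨a, M'.map (Function.Embedding.subtype _), ha1, ?_, ?_, ?_⟩
  · intro c hc
    obtain ⟨c', -, rfl⟩ := Finset.mem_map.mp hc
    exact c'.2
  · rw [Finset.card_map]
    have h1 : #M'ᶜ ≤ d := by
      rw [← Fintype.card_fin d, ← Finset.card_univ]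
      have h2 : ∀ c ∈ M'ᶜ, ∃ z, ν (Sum.inl c) = Sum.inr z := by
        intro c hc
        rcases h : ν (Sum.inl c) with c' | z
        · simp only [M', Finset.mem_compl, Finset.mem_filter, Finset.mem_univ, true_and] at hc
          exact absurd ⟨c', h⟩ hc
        · exact ⟨z, rfl⟩
      have h3 : M'ᶜ.image (ν ∘ Sum.inl) ⊆ Finset.univ.image Sum.inr := by
        intro y hy
        obtain ⟨c, hc, rfl⟩ := Finset.mem_image.mp hy
        obtain ⟨z, hz⟩ := h2 c hc
        exact Finset.mem_image.mpr ⟨z, Finset.mem_univ _, hz.symm⟩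
      have h4 := (Finset.card_le_card h3).trans Finset.card_image_le
      rwa [Finset.card_image_of_injective _ ((show Function.Involutive ν from
        hν).injective.comp Sum.inl_injective)] at h4
    have h2 := Finset.card_add_card_compl M'
    rw [Fintype.card_coe] at h2
    omega
  · intro c hc
    obtain ⟨c, hc', rfl⟩ := Finset.mem_map.mp hc
    simp only [M', Finset.mem_filter, Finset.mem_univ, true_and] at hc'
    obtain ⟨c', hc'⟩ := hc'
    simp only [Function.Embedding.subtype_apply]
    rw [hcompat c c' hc', ha1]
    refine ⟨?_, fun h => hne c c' hc' (Subtype.ext h.symm), rfl⟩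
    refine Finset.mem_map.mpr ⟨c', ?_, rfl⟩
    simp only [M', Finset.mem_filter, Finset.mem_univ, true_and]
    exact ⟨c, hsymm _ _ hc'⟩

/-- All representatives miss colour 0, so an edge joining two of them saves two. Each cycle in `M`
thus saves one. -/
theorem IsFrame.exists_colouring_of_selection (hF : IsFrame G σ μ) {a : PermOrbit σ → V}
    {M : Finset (PermOrbit σ)} (ha : ∀ c, permOrbit σ (a c) = c) (hM : M ⊆ oddOrbits σ)
    (hμ : ∀ c ∈ M, permOrbit σ (μ (a c)) ∈ M ∧ permOrbit σ (μ (a c)) ≠ c ∧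
      a (permOrbit σ (μ (a c))) = μ (a c)) :
    ∃ f : EdgeColouring G 4, f.numMedium + #M ≤ 5 * #(oddOrbits σ) := by
  classical
  obtain ⟨f, hf⟩ := hF.exists_special_colouring (b := fun c => σ (a c)) ha (fun c => Or.inl rfl)
  refine ⟨f, ?_⟩
  have hinj : Function.Injective a := fun c c' h => by rw [← ha c, h, ha]
  have hsp : ∀ c ∈ M, IsSpecial σ a (fun c => σ (a c)) (a c) ∧
      specialColour σ a (fun c => σ (a c)) (a c) = 0 := by
    intro c hc
    have h1 : IsSpecial σ a (fun c => σ (a c)) (a c) := by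
      unfold IsSpecial
      rw [ha]
      exact ⟨mem_oddOrbits.mp (hM hc), Or.inl rfl⟩
    refine ⟨h1, ?_⟩
    unfold specialColour
    rw [if_pos h1, ha, if_pos rfl]
  have h1 : #M ≤ #{v | (IsSpecial σ a (fun c => σ (a c)) v ∧
      IsSpecial σ a (fun c => σ (a c)) (μ v)) ∧
      specialColour σ a (fun c => σ (a c)) v = specialColour σ a (fun c => σ (a c)) (μ v)} := by
    rw [← Finset.card_image_of_injective M hinj]
    refine Finset.card_le_card fun v hv => ?_
    obtain ⟨c, hc, rfl⟩ := Finset.mem_image.mp hv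
    obtain ⟨h2, -, h3⟩ := hμ c hc
    have h4 := hsp c hc
    have h5 := hsp _ h2
    rw [h3] at h5
    simp [h4, h5]
  have h2 := Finset.card_le_card (s := ({v | (IsSpecial σ a (fun c => σ (a c)) v ∧
      IsSpecial σ a (fun c => σ (a c)) (μ v)) ∧
      specialColour σ a (fun c => σ (a c)) v = specialColour σ a (fun c => σ (a c)) (μ v)} :
      Finset V)) (t := ({v | IsSpecial σ a (fun c => σ (a c)) v ∧
      IsSpecial σ a (fun c => σ (a c)) (μ v)} : Finset V))
    (Finset.monotone_filter_right _ fun v _ h => h.1)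
  omega

theorem IsFrame.five_mul_le_card (hF : IsFrame G σ μ) : 5 * #(oddOrbits σ) ≤ Fintype.card V :=
  (hF.five_mul_card_le subset_rfl).trans (Finset.card_le_univ _)

/-- The choice of `d` is the largest even number with `5 * d ≤ n - 5 * k`. The surplus term is kept
because its vanishing characterises the extremal case. -/
theorem IsFrame.exists_numMedium_le (hF : IsFrame G σ μ) :
    ∃ f : EdgeColouring G 4, 5 * f.numMedium + 3 * (Fintype.card V - 5 * #(oddOrbits σ)) ≤
      4 * Fintype.card V := by
  have h1 := hF.five_mul_le_card
  obtain ⟨a, M, ha, hM, hMcard, hμ⟩ := hF.exists_selection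
    (d := 2 * ((Fintype.card V - 5 * #(oddOrbits σ)) / 10)) (by simp) (by omega)
  obtain ⟨f, hf⟩ := hF.exists_colouring_of_selection ha hM hμ
  exact ⟨f, by omega⟩

end OrbitMatching

/-! ### The extremal case: all cycles are pentagons -/

section PentagonFrame

/-- A frame all of whose cycles are pentagons, in a graph without colourings with fewer than four
medium edges per pentagon. -/
structure IsTightFrame {V : Type*} [Fintype V] [DecidableEq V] (G : SimpleGraph V)
    (σ : Equiv.Perm V) (μ : V → V) : Prop extends IsFrame G σ μ where
  card_orbit : ∀ c, #(orbitFinset σ c) = 5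
  le_numMedium : ∀ f : EdgeColouring G 4, 4 * #(oddOrbits σ) ≤ f.numMedium

variable {V : Type*} [Fintype V] [DecidableEq V] {G : SimpleGraph V} {σ : Equiv.Perm V} {μ : V → V}

theorem isCycleOn_orbitFinset (σ : Equiv.Perm V) (c : PermOrbit σ) :
    σ.IsCycleOn (orbitFinset σ c : Set V) := by
  refine ⟨⟨fun v hv => ?_, σ.injective.injOn, fun v hv => ⟨σ.symm v, ?_, by simp⟩⟩, ?_⟩
  · simpa using hv
  · simpa using hv
  · intro u hu v hv
    simp only [Finset.mem_coe, mem_orbitFinset] at hu hv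
    exact permOrbit_eq_iff.mp (hu.trans hv.symm)

namespace IsTightFrame

theorem pow_apply_eq (h : IsTightFrame G σ μ) (v : V) (n : ℕ) : (σ ^ n) v = v ↔ 5 ∣ n := by
  rw [(isCycleOn_orbitFinset σ (permOrbit σ v)).pow_apply_eq (by simp), h.card_orbit]

theorem apply_five (h : IsTightFrame G σ μ) (v : V) : σ (σ (σ (σ (σ v)))) = v :=
  (h.pow_apply_eq v 5).mpr (dvd_refl 5)

theorem apply_two_ne (h : IsTightFrame G σ μ) (v : V) : σ (σ v) ≠ v :=
  fun h' => absurd ((h.pow_apply_eq v 2).mp h') (by decide)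

theorem apply_three_ne (h : IsTightFrame G σ μ) (v : V) : σ (σ (σ v)) ≠ v :=
  fun h' => absurd ((h.pow_apply_eq v 3).mp h') (by decide)

theorem apply_four_ne (h : IsTightFrame G σ μ) (v : V) : σ (σ (σ (σ v))) ≠ v :=
  fun h' => absurd ((h.pow_apply_eq v 4).mp h') (by decide)

theorem orbit_cases (h : IsTightFrame G σ μ) {u v : V} (huv : permOrbit σ u = permOrbit σ v) :
    u = v ∨ u = σ v ∨ u = σ (σ v) ∨ u = σ (σ (σ v)) ∨ u = σ (σ (σ (σ v))) := by
  obtain ⟨n, hn, rfl⟩ := (isCycleOn_orbitFinset σ (permOrbit σ v)).exists_pow_eq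
    (a := v) (b := u) (by simp) (by simp [huv])
  rw [h.card_orbit] at hn
  interval_cases n
  · exact Or.inl rfl
  · exact Or.inr (Or.inl rfl)
  · exact Or.inr (Or.inr (Or.inl rfl))
  · exact Or.inr (Or.inr (Or.inr (Or.inl rfl)))
  · exact Or.inr (Or.inr (Or.inr (Or.inr rfl)))

theorem mem_oddOrbits (h : IsTightFrame G σ μ) (c : PermOrbit σ) : c ∈ oddOrbits σ := by
  rw [_root_.mem_oddOrbits, h.card_orbit]
  decide

theorem card_eq (h : IsTightFrame G σ μ) : Fintype.card V = #(oddOrbits σ) * 5 := by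
  have h1 : orbitUnion σ (oddOrbits σ) = Finset.univ := by
    ext v
    simp [h.mem_oddOrbits]
  rw [← Finset.card_univ, ← h1, card_orbitUnion]
  simp [h.card_orbit]

/-- At least five matching edges leave a pentagon, so all of its vertices are matched outside. -/
theorem permOrbit_mu_ne (h : IsTightFrame G σ μ) (v : V) :
    permOrbit σ (μ v) ≠ permOrbit σ v := by
  have h1 := h.five_le (orbitFinset σ (permOrbit σ v)) (by rw [h.card_orbit]; decide)
    (fun v => by simp)
  unfold crossing at h1
  have h2 := Finset.eq_of_subset_of_card_le (Finset.filter_subset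
    (fun u => μ u ∉ orbitFinset σ (permOrbit σ v)) (orbitFinset σ (permOrbit σ v)))
    (by rw [h.card_orbit]; exact h1)
  have h3 : v ∈ orbitFinset σ (permOrbit σ v) := by simp
  rw [← h2, Finset.mem_filter, mem_orbitFinset] at h3
  simpa using h3.2

theorem isSpecial_iff (h : IsTightFrame G σ μ) {a b : PermOrbit σ → V} {v : V} :
    IsSpecial σ a b v ↔ v = a (permOrbit σ v) ∨ v = b (permOrbit σ v) := by
  unfold IsSpecial
  rw [h.card_orbit]
  exact and_iff_right (by decide)

/-- A full set of special vertices matched with the same colour leaves no other special vertices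
matched with each other. -/
theorem mem_of_isSpecial (h : IsTightFrame G σ μ) {a b : PermOrbit σ → V}
    (ha : ∀ c, permOrbit σ (a c) = c) (hab : ∀ c, b c = σ (a c) ∨ a c = σ (b c)) {P : Finset V}
    (hP : ∀ v ∈ P, (IsSpecial σ a b v ∧ IsSpecial σ a b (μ v)) ∧
      specialColour σ a b v = specialColour σ a b (μ v)) (hcard : #(oddOrbits σ) ≤ #P) {v : V}
    (hv : IsSpecial σ a b v) (hμv : IsSpecial σ a b (μ v)) : v ∈ P := by
  classical
  by_contra hvP
  obtain ⟨f, hf⟩ := h.exists_special_colouring ha hab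
  have h1 := h.le_numMedium f
  have h2 : #P ≤ #{v | (IsSpecial σ a b v ∧ IsSpecial σ a b (μ v)) ∧
      specialColour σ a b v = specialColour σ a b (μ v)} :=
    Finset.card_le_card fun v hv => by simpa using hP v hv
  have h3 : #(insert v P) ≤ #{v | IsSpecial σ a b v ∧ IsSpecial σ a b (μ v)} := by
    refine Finset.card_le_card fun u hu => ?_
    rcases Finset.mem_insert.mp hu with rfl | hu
    · simp [hv, hμv]
    · simpa using (hP u hu).1
  -- With `k` pentagons, the colouring bound becomes `2 * f.numMedium + (k + 1) + k ≤ 10 * k`,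
  -- against `4 * k ≤ f.numMedium`.
  rw [Finset.card_insert_of_notMem hvP] at h3
  omega

end IsTightFrame

/-- Representatives of all cycles that are perfectly matched by `μ`. -/
structure IsSelection (σ : Equiv.Perm V) (μ : V → V) (a : PermOrbit σ → V) : Prop where
  orbit : ∀ c, permOrbit σ (a c) = c
  apply_mu : ∀ c, a (permOrbit σ (μ (a c))) = μ (a c)

/-- The neighbours of the representatives on their cycles. -/
def IsNear (σ : Equiv.Perm V) (a : PermOrbit σ → V) (v : V) : Prop :=
  v = σ (a (permOrbit σ v)) ∨ a (permOrbit σ v) = σ v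

theorem IsSelection.injective {a : PermOrbit σ → V} (hs : IsSelection σ μ a) :
    Function.Injective a := fun c c' h => by rw [← hs.orbit c, h, hs.orbit]

namespace IsTightFrame

variable {a : PermOrbit σ → V}

theorem ne_of_isNear (h : IsTightFrame G σ μ) {v : V} (hv : IsNear σ a v) :
    v ≠ a (permOrbit σ v) := by
  intro h'
  rcases hv with hv | hv
  · exact h.ne (a (permOrbit σ v)) (hv.symm.trans h')
  · exact h.ne v (hv.symm.trans h'.symm)

/-- Two matched near vertices could both be taken as second special vertices, a saving beyond that
of the representatives. -/
theorem not_isNear_mu_of_isNear (h : IsTightFrame G σ μ) (hs : IsSelection σ μ a) {v : V}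
    (hv : IsNear σ a v) : ¬ IsNear σ a (μ v) ∧ μ v ≠ a (permOrbit σ (μ v)) := by
  classical
  constructor
  · intro hμv
    have hne := h.permOrbit_mu_ne v
    set b : PermOrbit σ → V := fun c =>
      if c = permOrbit σ v then v else if c = permOrbit σ (μ v) then μ v else σ (a c) with hb
    have hbv : b (permOrbit σ v) = v := by simp [hb]
    have hbμ : b (permOrbit σ (μ v)) = μ v := by simp [hb, hne]
    have hab : ∀ c, b c = σ (a c) ∨ a c = σ (b c) := by
      intro c
      by_cases h1 : c = permOrbit σ v
      · rw [h1, hbv]; exact hv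
      by_cases h2 : c = permOrbit σ (μ v)
      · rw [h2, hbμ]; exact hμv
      exact Or.inl (by simp [hb, h1, h2])
    have hsp : ∀ c, IsSpecial σ a b (a c) ∧ specialColour σ a b (a c) = 0 := by
      intro c
      have h1 : IsSpecial σ a b (a c) := h.isSpecial_iff.mpr (Or.inl (by rw [hs.orbit]))
      refine ⟨h1, ?_⟩
      unfold specialColour
      rw [if_pos h1, hs.orbit, if_pos rfl]
    have hmem := h.mem_of_isSpecial hs.orbit hab (P := (oddOrbits σ).image a) (v := v)
      (by
        intro u hu
        obtain ⟨c, -, rfl⟩ := Finset.mem_image.mp hu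
        have h1 := hsp c
        have h2 := hsp (permOrbit σ (μ (a c)))
        rw [hs.apply_mu] at h2
        exact ⟨⟨h1.1, h2.1⟩, h1.2.trans h2.2.symm⟩)
      (by rw [Finset.card_image_of_injective _ hs.injective])
      (h.isSpecial_iff.mpr (Or.inr hbv.symm)) (h.isSpecial_iff.mpr (Or.inr hbμ.symm))
    obtain ⟨c, -, hc⟩ := Finset.mem_image.mp hmem
    refine h.ne_of_isNear hv ?_
    rw [← hc, hs.orbit]
  · intro h'
    have h1 := hs.apply_mu (permOrbit σ (μ v))
    rw [← h', h.invol] at h1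
    exact h.ne_of_isNear hv h1.symm

/-- Of the `5 * k` vertices, `k` are representatives, `2 * k` near and `2 * k` far. As `μ` sends
near vertices to far ones injectively, it reaches all of the far ones. -/
theorem isNear_mu_of_not_isNear (h : IsTightFrame G σ μ) (hs : IsSelection σ μ a) {v : V}
    (hv : ¬ IsNear σ a v) (hva : v ≠ a (permOrbit σ v)) : IsNear σ a (μ v) := by
  classical
  have hinj : Function.Injective μ := (show Function.Involutive μ from h.invol).injective
  set N : Finset V := {v | IsNear σ a v} with hN
  set A : Finset V := (oddOrbits σ).image a with hA
  have hAcard : #A = #(oddOrbits σ) := Finset.card_image_of_injective _ hs.injective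
  have hAN : Disjoint A N := by
    rw [Finset.disjoint_left]
    intro u hu hu'
    obtain ⟨c, -, rfl⟩ := Finset.mem_image.mp hu
    refine h.ne_of_isNear (Finset.mem_filter.mp hu').2 ?_
    rw [hs.orbit]
  have hNcard : 2 * #(oddOrbits σ) ≤ #N := by
    have h1 : A.image σ ∪ A.image σ.symm ⊆ N := by
      intro u hu
      rw [hN, Finset.mem_filter]
      refine ⟨Finset.mem_univ _, ?_⟩
      rcases Finset.mem_union.mp hu with hu | hu
      · obtain ⟨w, hw, rfl⟩ := Finset.mem_image.mp hu
        obtain ⟨c, -, rfl⟩ := Finset.mem_image.mp hw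
        left
        rw [permOrbit_apply, hs.orbit]
      · obtain ⟨w, hw, rfl⟩ := Finset.mem_image.mp hu
        obtain ⟨c, -, rfl⟩ := Finset.mem_image.mp hw
        right
        rw [permOrbit_symm_apply, hs.orbit, Equiv.apply_symm_apply]
    have h2 : Disjoint (A.image σ) (A.image σ.symm) := by
      rw [Finset.disjoint_left]
      intro u hu hu'
      obtain ⟨w, hw, rfl⟩ := Finset.mem_image.mp hu
      obtain ⟨c, -, rfl⟩ := Finset.mem_image.mp hw
      obtain ⟨w', hw', h3⟩ := Finset.mem_image.mp hu'
      obtain ⟨c', -, rfl⟩ := Finset.mem_image.mp hw'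
      have h4 := congrArg (permOrbit σ) h3
      rw [permOrbit_symm_apply, permOrbit_apply, hs.orbit, hs.orbit] at h4
      subst h4
      rw [Equiv.symm_apply_eq] at h3
      exact h.sq_ne _ h3.symm
    have h3 := Finset.card_le_card h1
    rw [Finset.card_union_of_disjoint h2, Finset.card_image_of_injective _ σ.injective,
      Finset.card_image_of_injective _ σ.symm.injective, hAcard] at h3
    omega
  have hsub : N.image μ ⊆ (A ∪ N)ᶜ := by
    intro u hu
    obtain ⟨w, hw, rfl⟩ := Finset.mem_image.mp hu
    obtain ⟨h1, h2⟩ := h.not_isNear_mu_of_isNear hs (Finset.mem_filter.mp hw).2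
    rw [Finset.mem_compl, Finset.mem_union, not_or]
    refine ⟨fun h3 => ?_, fun h3 => h1 (Finset.mem_filter.mp h3).2⟩
    obtain ⟨c, -, hc⟩ := Finset.mem_image.mp h3
    exact h2 (by rw [← hc, hs.orbit])
  have heq := Finset.eq_of_subset_of_card_le hsub (by
    have h1 := h.card_eq
    rw [Finset.card_compl, Finset.card_image_of_injective _ hinj,
      Finset.card_union_of_disjoint hAN]
    omega)
  have hmem : v ∈ (A ∪ N)ᶜ := by
    rw [Finset.mem_compl, Finset.mem_union, not_or]
    refine ⟨fun h3 => ?_, fun h3 => hv (Finset.mem_filter.mp h3).2⟩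
    obtain ⟨c, -, rfl⟩ := Finset.mem_image.mp h3
    exact hva (by rw [hs.orbit])
  rw [← heq] at hmem
  obtain ⟨w, hw, rfl⟩ := Finset.mem_image.mp hmem
  rw [h.invol]
  exact (Finset.mem_filter.mp hw).2

/-- Recolouring along an edge between cycles that are not matched to each other. -/
theorem orbit_mu_of_crossing (h : IsTightFrame G σ μ) (hs : IsSelection σ μ a) {x f : V}
    (hx : IsNear σ a x) (hcross : permOrbit σ (μ x) ≠ permOrbit σ (μ (a (permOrbit σ x))))
    (hf : permOrbit σ f = permOrbit σ (μ (a (permOrbit σ (μ x))))) (hμf : IsNear σ a (μ f)) :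
    permOrbit σ (μ f) = permOrbit σ x ∨
      (permOrbit σ (μ f) = permOrbit σ (μ x) ∧ μ f ≠ σ (μ x) ∧ μ x ≠ σ (μ f)) := by
  classical
  by_contra hcon
  push Not at hcon
  obtain ⟨hEC, hED⟩ := hcon
  set y := μ x with hy
  set g := μ f with hg
  set C := permOrbit σ x with hC
  set D := permOrbit σ y with hD
  set E := permOrbit σ g with hE
  set D' := permOrbit σ f with hD'
  have hDC : D ≠ C := h.permOrbit_mu_ne x
  have hDD' : D ≠ D' := by
    rw [hf]
    intro h1
    have := h.permOrbit_mu_ne (a D)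
    rw [hs.orbit, ← h1] at this
    exact this rfl
  have haD' : a D' = μ (a D) := by rw [hf, hs.apply_mu]
  have haD : μ (a D') = a D := by rw [haD', h.invol]
  have hCD' : C ≠ D' := by
    intro h1
    rw [h1, haD, hs.orbit] at hcross
    exact hcross rfl
  have hED' : E ≠ D' := h.permOrbit_mu_ne f
  -- Replace the saving edge between `D` and its partner `D'` by the edge `xy`, whose ends are now
  -- second special vertices of colour 1. This frees the first special vertex on `D` and both on
  -- `D'`, so that `f` and `g` can be made special as well. Only if `E = C`, or `E = D` with `g` not
  -- adjacent to `y`, do these choices conflict.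
  set y' := if E = D then g else σ y with hy'
  set a' : PermOrbit σ → V := fun c => if c = D then y' else if c = D' then f else a c with ha'
  set b' : PermOrbit σ → V := fun c => if c = D then y else if c = C then x else
    if c = D' then σ f else if c = E then g else σ (a c) with hb'
  have ha'D : a' D = y' := by simp [ha']
  have ha'D' : a' D' = f := by simp [ha', hDD'.symm]
  have ha'o : ∀ c, c ≠ D → c ≠ D' → a' c = a c := fun c h1 h2 => by simp [ha', h1, h2]
  have hb'D : b' D = y := by simp [hb']
  have hb'C : b' C = x := by simp [hb', hDC.symm]
  have hb'D' : b' D' = σ f := by simp [hb', hDD'.symm, hCD'.symm]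
  have hb'E : E ≠ D → b' E = g := fun h1 => by simp [hb', h1, hEC, hED']
  have hgy : g ≠ y := by
    intro h1
    have h2 : x = f := by
      rw [← h.invol x, ← hy, ← h1, hg, h.invol]
    exact hCD' (by rw [hC, hD', h2])
  have hy'adj : y = σ y' ∨ y' = σ y := by
    by_cases h1 : E = D
    · simp only [hy', if_pos h1]
      by_cases h2 : g = σ y
      · exact Or.inr h2
      · exact Or.inl (hED h1 h2)
    · simp [hy', h1]
  have hyy' : y ≠ y' := by
    intro h1
    rw [← h1] at hy'adj
    rcases hy'adj with h2 | h2 <;> exact h.ne y h2.symm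
  have hy'D : permOrbit σ y' = D := by
    by_cases h1 : E = D
    · simp only [hy', if_pos h1]; exact h1
    · simp only [hy', if_neg h1, permOrbit_apply]; rfl
  have ha'orb : ∀ c, permOrbit σ (a' c) = c := by
    intro c
    by_cases h1 : c = D
    · rw [h1, ha'D, hy'D]
    by_cases h2 : c = D'
    · rw [h2, ha'D']
    rw [ha'o c h1 h2, hs.orbit]
  have hab' : ∀ c, b' c = σ (a' c) ∨ a' c = σ (b' c) := by
    intro c
    by_cases h1 : c = D
    · rw [h1, ha'D, hb'D]; exact hy'adj
    by_cases h2 : c = D'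
    · rw [h2, ha'D', hb'D']; exact Or.inl rfl
    rw [ha'o c h1 h2]
    by_cases h3 : c = C
    · rw [h3, hb'C]; exact hx
    by_cases h4 : c = E
    · rw [h4, hb'E (by rw [← h4]; exact h1)]; exact hμf
    exact Or.inl (by simp [hb', h1, h2, h3, h4])
  have hspa : ∀ c, IsSpecial σ a' b' (a' c) ∧ specialColour σ a' b' (a' c) = 0 := by
    intro c
    have h1 : IsSpecial σ a' b' (a' c) := h.isSpecial_iff.mpr (Or.inl (by rw [ha'orb]))
    refine ⟨h1, ?_⟩
    unfold specialColour
    rw [if_pos h1, ha'orb, if_pos rfl]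
  have hspb : ∀ v, b' (permOrbit σ v) = v → v ≠ a' (permOrbit σ v) →
      IsSpecial σ a' b' v ∧ specialColour σ a' b' v = 1 := by
    intro v h1 h2
    have h3 : IsSpecial σ a' b' v := h.isSpecial_iff.mpr (Or.inr h1.symm)
    refine ⟨h3, ?_⟩
    unfold specialColour
    rw [if_pos h3, if_neg h2]
  have hspx := hspb x hb'C (by rw [← hC, ha'o C hDC.symm hCD']; exact h.ne_of_isNear hx)
  have hspy := hspb y hb'D (by rw [← hD, ha'D]; exact hyy')
  have hspf := hspa D'
  rw [ha'D'] at hspf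
  have hspg : IsSpecial σ a' b' g := by
    by_cases h1 : E = D
    · have h2 := (hspa D).1
      rw [ha'D, hy', if_pos h1] at h2
      exact h2
    · exact h.isSpecial_iff.mpr (Or.inr (hb'E h1).symm)
  set R := ((oddOrbits σ).erase D).erase D' with hR
  have hRmem : ∀ c, c ∈ R ↔ c ≠ D' ∧ c ≠ D := fun c => by
    simp [hR, h.mem_oddOrbits]
  have hxR : x ∉ R.image a := by
    intro h1
    obtain ⟨c, -, hc⟩ := Finset.mem_image.mp h1
    exact h.ne_of_isNear hx (by rw [← hc, hs.orbit])
  have hyR : y ∉ R.image a := by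
    intro h1
    obtain ⟨c, hc', hc⟩ := Finset.mem_image.mp h1
    refine ((hRmem c).mp hc').2 ?_
    rw [hD, ← hc, hs.orbit]
  have hxy : x ≠ y := fun h1 => hDC (by rw [hD, hC, ← h1])
  -- The `k - 2` remaining representatives together with `x` and `y` already make up the full count
  -- `k`, so the pair `f`, `g` is surplus.
  have hmem := h.mem_of_isSpecial ha'orb hab' (P := insert x (insert y (R.image a))) (v := f)
    (by
      intro u hu
      rcases Finset.mem_insert.mp hu with rfl | hu
      · exact ⟨⟨hspx.1, hspy.1⟩, hspx.2.trans hspy.2.symm⟩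
      rcases Finset.mem_insert.mp hu with rfl | hu
      · rw [hy, h.invol]
        exact ⟨⟨hspy.1, hspx.1⟩, hspy.2.trans hspx.2.symm⟩
      obtain ⟨c, hc, rfl⟩ := Finset.mem_image.mp hu
      obtain ⟨h1, h2⟩ := (hRmem c).mp hc
      have h3 := hspa c
      have h4 := hspa (permOrbit σ (μ (a c)))
      have h5 : ∀ c', c ≠ c' → permOrbit σ (μ (a c)) ≠ permOrbit σ (μ (a c')) := by
        intro c' hne h6
        have h7 := hs.apply_mu c
        rw [h6, hs.apply_mu] at h7
        exact hne (hs.injective ((show Function.Involutive μ from h.invol).injective h7.symm))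
      have h6 := h5 _ h1
      have h7 := h5 _ h2
      rw [haD, hs.orbit] at h6
      rw [← hf] at h7
      rw [ha'o c h2 h1] at h3
      rw [ha'o _ h6 h7, hs.apply_mu] at h4
      exact ⟨⟨h3.1, h4.1⟩, h3.2.trans h4.2.symm⟩)
    (by
      rw [Finset.card_insert_of_notMem (by simp only [Finset.mem_insert, not_or]; exact ⟨hxy, hxR⟩),
        Finset.card_insert_of_notMem hyR, Finset.card_image_of_injective _ hs.injective, hR,
        Finset.card_erase_of_mem (by simp [hDD'.symm, h.mem_oddOrbits]),
        Finset.card_erase_of_mem (h.mem_oddOrbits D)]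
      omega)
    hspf.1 hspg
  rcases Finset.mem_insert.mp hmem with h1 | h1
  · exact hCD' (by rw [hC, hD', h1])
  rcases Finset.mem_insert.mp h1 with h1 | h1
  · exact hDD' (by rw [hD, hD', h1])
  obtain ⟨c, hc, hc'⟩ := Finset.mem_image.mp h1
  refine ((hRmem c).mp hc).1 ?_
  rw [hD', ← hc', hs.orbit]

end IsTightFrame

end PentagonFrame

/-! ### Matching edges stay within pairs of pentagons -/

section NoCrossing

variable {V : Type*} [Fintype V] [DecidableEq V] {G : SimpleGraph V} {σ : Equiv.Perm V} {μ : V → V}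
  {a : PermOrbit σ → V}

namespace IsTightFrame

theorem eq_of_isNear (h : IsTightFrame G σ μ) {v : V} (hv : IsNear σ a v) :
    v = σ (a (permOrbit σ v)) ∨ v = σ (σ (σ (σ (a (permOrbit σ v))))) := by
  rcases hv with hv | hv
  · exact Or.inl hv
  · right
    rw [hv, h.apply_five]

theorem isNear_cases (h : IsTightFrame G σ μ) {u v w : V} (hu : IsNear σ a u) (hv : IsNear σ a v)
    (hw : IsNear σ a w) (huv : permOrbit σ u = permOrbit σ v) (huw : permOrbit σ u = permOrbit σ w)
    (hne : u ≠ v) : w = u ∨ w = v := by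
  have h1 := h.eq_of_isNear hu
  have h2 := h.eq_of_isNear hv
  have h3 := h.eq_of_isNear hw
  rw [← huv] at h2
  rw [← huw] at h3
  generalize a (permOrbit σ u) = z at *
  rcases h1 with h1 | h1 <;> rcases h2 with h2 | h2 <;> rcases h3 with h3 | h3 <;>
    first
    | exact absurd (h1.trans h2.symm) hne
    | exact Or.inl (h3.trans h1.symm)
    | exact Or.inr (h3.trans h2.symm)

theorem adj_of_not_isNear (h : IsTightFrame G σ μ) (hs : IsSelection σ μ a) {u v y : V}
    (hu : IsNear σ a u) (hv : IsNear σ a v) (huv : permOrbit σ u = permOrbit σ v) (hne : u ≠ v)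
    (huy : permOrbit σ u = permOrbit σ y) (hy : ¬ IsNear σ a y) (hya : y ≠ a (permOrbit σ y)) :
    (u = σ y ∨ y = σ u) ∨ (v = σ y ∨ y = σ v) := by
  have h1 := h.eq_of_isNear hu
  have h2 := h.eq_of_isNear hv
  rw [← huv] at h2
  have h3 := h.orbit_cases (u := y) (v := a (permOrbit σ u)) (by rw [hs.orbit, huy])
  unfold IsNear at hy
  rw [← huy] at hya hy
  push Not at hy
  have h5 := h.apply_five
  generalize a (permOrbit σ u) = z at *
  rcases h3 with h3 | h3 | h3 | h3 | h3
  · exact absurd h3 hya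
  · exact absurd h3 hy.1
  · rcases h1 with h1 | h1
    · exact Or.inl (Or.inr (by rw [h3, h1]))
    · rcases h2 with h2 | h2
      · exact Or.inr (Or.inr (by rw [h3, h2]))
      · exact absurd (h1.trans h2.symm) hne
  · rcases h1 with h1 | h1
    · rcases h2 with h2 | h2
      · exact absurd (h1.trans h2.symm) hne
      · exact Or.inr (Or.inl (by rw [h3, h2]))
    · exact Or.inl (Or.inl (by rw [h3, h1]))
  · exact absurd (by rw [h3, h5]) hy.2

theorem exists_far_pair (h : IsTightFrame G σ μ) (hs : IsSelection σ μ a) (c : PermOrbit σ) :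
    ∃ f f', f ≠ f' ∧ permOrbit σ f = c ∧ permOrbit σ f' = c ∧ IsNear σ a (μ f) ∧
      IsNear σ a (μ f') := by
  have h2 := h.apply_two_ne
  have h3 := h.apply_three_ne
  have h4 := h.apply_four_ne
  have hc := hs.orbit c
  refine ⟨σ (σ (a c)), σ (σ (σ (a c))), (h.ne _).symm, by simp [hc], by simp [hc],
    h.isNear_mu_of_not_isNear hs ?_ ?_, h.isNear_mu_of_not_isNear hs ?_ ?_⟩
  · simp only [IsNear, permOrbit_apply, hc, not_or]
    exact ⟨h.ne _, fun h' => h3 _ h'.symm⟩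
  · simp only [permOrbit_apply, hc]
    exact h2 _
  · simp only [IsNear, permOrbit_apply, hc, not_or]
    exact ⟨h2 _, fun h' => h4 _ h'.symm⟩
  · simp only [permOrbit_apply, hc]
    exact h3 _

/-- Across a crossing edge, the partner of the far cycle is joined to both cycles. -/
theorem exists_of_crossing (h : IsTightFrame G σ μ) (hs : IsSelection σ μ a) {x : V}
    (hx : IsNear σ a x) (hcross : permOrbit σ (μ x) ≠ permOrbit σ (μ (a (permOrbit σ x)))) :
    (∃ f, permOrbit σ f = permOrbit σ (μ (a (permOrbit σ (μ x)))) ∧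
      permOrbit σ (μ f) = permOrbit σ x ∧ IsNear σ a (μ f) ∧ μ f ≠ x) ∧
    ∃ f, permOrbit σ f = permOrbit σ (μ (a (permOrbit σ (μ x)))) ∧
      permOrbit σ (μ f) = permOrbit σ (μ x) ∧ IsNear σ a (μ f) ∧ μ f ≠ σ (μ x) ∧
      μ x ≠ σ (μ f) := by
  have hinj : Function.Injective μ := (show Function.Involutive μ from h.invol).injective
  obtain ⟨f, f', hne, hf, hf', hn, hn'⟩ :=
    h.exists_far_pair hs (permOrbit σ (μ (a (permOrbit σ (μ x)))))
  obtain ⟨hy1, hy2⟩ := h.not_isNear_mu_of_isNear hs hx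
  have hμne : μ f ≠ μ f' := fun h' => hne (hinj h')
  have hnex : ∀ g, permOrbit σ g = permOrbit σ (μ (a (permOrbit σ (μ x)))) → μ g ≠ x := by
    intro g hg h'
    have h1 : g = μ x := by rw [← h', h.invol]
    have h2 := h.permOrbit_mu_ne (a (permOrbit σ (μ x)))
    rw [hs.orbit, ← hg, h1] at h2
    exact h2 rfl
  -- The two far vertices of the partner cycle are matched to distinct near vertices. Both cannot
  -- lie on the cycle of `x`, where `x` already takes one of the two near places. Both cannot lie on
  -- the cycle of `μ x`, since the far vertex `μ x` is adjacent to one of its two near vertices.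
  rcases h.orbit_mu_of_crossing hs hx hcross hf hn with h1 | ⟨h1, h2, h3⟩ <;>
    rcases h.orbit_mu_of_crossing hs hx hcross hf' hn' with h4 | ⟨h4, h5, h6⟩
  · exfalso
    rcases h.isNear_cases hn hn' hx (h1.trans h4.symm) h1 hμne with h5 | h5
    · exact hnex f hf h5.symm
    · exact hnex f' hf' h5.symm
  · exact ⟨⟨f, hf, h1, hn, hnex f hf⟩, f', hf', h4, hn', h5, h6⟩
  · exact ⟨⟨f', hf', h4, hn', hnex f' hf'⟩, f, hf, h1, hn, h2, h3⟩
  · exfalso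
    have h7 := h.adj_of_not_isNear hs hn hn' (h1.trans h4.symm) hμne h1 hy1 hy2
    tauto

theorem orbit_mu_of_isNear (h : IsTightFrame G σ μ) (hs : IsSelection σ μ a) {x : V}
    (hx : IsNear σ a x) : permOrbit σ (μ x) = permOrbit σ (μ (a (permOrbit σ x))) := by
  by_contra hcross
  have hinj : Function.Injective μ := (show Function.Involutive μ from h.invol).injective
  obtain ⟨-, f, hf, hfD, hfn, hf1, hf2⟩ := h.exists_of_crossing hs hx hcross
  obtain ⟨hy1, hy2⟩ := h.not_isNear_mu_of_isNear hs hx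
  have hDC := h.permOrbit_mu_ne x
  -- Let `p` be the near vertex adjacent to `μ x`; the vertex `μ f` is the other near vertex of that
  -- cycle.
  obtain ⟨p, hpD, hpn, hpadj⟩ : ∃ p, permOrbit σ p = permOrbit σ (μ x) ∧ IsNear σ a p ∧
      (p = σ (μ x) ∨ μ x = σ p) := by
    have h1 : permOrbit σ (σ (a (permOrbit σ (μ x)))) = permOrbit σ (μ x) := by
      rw [permOrbit_apply, hs.orbit]
    have h2 : permOrbit σ (σ.symm (a (permOrbit σ (μ x)))) = permOrbit σ (μ x) := by
      rw [permOrbit_symm_apply, hs.orbit]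
    have h3 : IsNear σ a (σ (a (permOrbit σ (μ x)))) := Or.inl (by rw [h1])
    have h4 : IsNear σ a (σ.symm (a (permOrbit σ (μ x)))) :=
      Or.inr (by rw [h2, Equiv.apply_symm_apply])
    have h5 : σ (a (permOrbit σ (μ x))) ≠ σ.symm (a (permOrbit σ (μ x))) := by
      intro h'
      rw [Equiv.eq_symm_apply] at h'
      exact h.sq_ne _ h'
    rcases h.adj_of_not_isNear hs h3 h4 (h1.trans h2.symm) h5 h1 hy1 hy2 with h6 | h6
    · exact ⟨_, h1, h3, h6⟩
    · exact ⟨_, h2, h4, h6⟩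
  have hpf : p ≠ μ f := by
    rintro rfl
    tauto
  -- If `p` is matched into the partner cycle, `orbit_mu_of_crossing` applied to `μ p` forbids its
  -- adjacency to `μ x`. Otherwise `p` also crosses, and the vertex `g` supplied for it must equal
  -- `f`. Two cycles then share a partner and coincide, although `p` is matched from one to the
  -- other.
  by_cases hE : permOrbit σ (μ p) = permOrbit σ (μ (a (permOrbit σ p)))
  · rw [hpD] at hE
    rcases h.orbit_mu_of_crossing hs hx hcross hE (by rwa [h.invol]) with h1 | h1
    · rw [h.invol, hpD] at h1
      exact hDC h1
    · rw [h.invol] at h1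
      tauto
  · obtain ⟨⟨g, hg, hgD, hgn, hgp⟩, -⟩ := h.exists_of_crossing hs hpn hE
    have h1 : μ g = μ f := by
      rcases h.isNear_cases hpn hfn hgn (hpD.trans hfD.symm) hgD.symm hpf with h2 | h2
      · exact absurd h2 hgp
      · exact h2
    have h2 := hinj h1
    rw [h2, hf] at hg
    have h3 : permOrbit σ (μ x) = permOrbit σ (μ p) := by
      have h4 := congrArg (fun c => permOrbit σ (μ (a c))) hg
      simp only [hs.apply_mu, h.invol, hs.orbit] at h4
      exact h4
    exact h.permOrbit_mu_ne p (h3.symm.trans hpD.symm)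

theorem orbit_mu (h : IsTightFrame G σ μ) (hs : IsSelection σ μ a) (v : V) :
    permOrbit σ (μ v) = permOrbit σ (μ (a (permOrbit σ v))) := by
  by_cases h1 : v = a (permOrbit σ v)
  · rw [← h1]
  by_cases h2 : IsNear σ a v
  · exact h.orbit_mu_of_isNear hs h2
  · have h3 := h.orbit_mu_of_isNear hs (h.isNear_mu_of_not_isNear hs h2 h1)
    rw [h.invol] at h3
    rw [h3, hs.apply_mu, h.invol, hs.orbit]

/-- Tight frames of connected graphs consist of two cycles. -/
theorem orbit_eq_or (h : IsTightFrame G σ μ) (hs : IsSelection σ μ a) (hconn : G.Connected)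
    (u v : V) : permOrbit σ v = permOrbit σ u ∨ permOrbit σ v = permOrbit σ (μ u) := by
  obtain ⟨p⟩ := hconn.preconnected u v
  have key : ∀ x y, G.Walk x y →
      (permOrbit σ x = permOrbit σ u ∨ permOrbit σ x = permOrbit σ (μ u)) →
      (permOrbit σ y = permOrbit σ u ∨ permOrbit σ y = permOrbit σ (μ u)) := by
    intro x y p
    induction p with
    | nil => exact id
    | cons hadj p ih =>
      intro hx
      refine ih ?_
      rcases (h.adj _ _).mp hadj with rfl | rfl | rfl
      · rwa [permOrbit_apply]
      · rwa [permOrbit_apply] at hx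
      · rw [h.orbit_mu hs, h.orbit_mu hs u]
        rcases hx with hx | hx
        · exact Or.inr (by rw [hx])
        · rw [hx, h.orbit_mu hs u, hs.apply_mu, h.invol, hs.orbit]
          exact Or.inl rfl
  exact key u v p (Or.inl rfl)

theorem isSelection_of_two (h : IsTightFrame G σ μ) {u : V}
    (h2 : ∀ v, permOrbit σ v = permOrbit σ u ∨ permOrbit σ v = permOrbit σ (μ u)) :
    ∃ a, IsSelection σ μ a ∧ a (permOrbit σ u) = u := by
  classical
  have hne := h.permOrbit_mu_ne u
  refine ⟨fun c => if c = permOrbit σ u then u else μ u, ⟨fun c => ?_, fun c => ?_⟩, by simp⟩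
  · obtain ⟨v, rfl⟩ := Quotient.exists_rep c
    change permOrbit σ (if permOrbit σ v = permOrbit σ u then u else μ u) = permOrbit σ v
    rcases h2 v with h3 | h3
    · simp [h3]
    · rw [if_neg (by rw [h3]; exact hne), h3]
  · by_cases hc : c = permOrbit σ u
    · simp [hc, hne]
    · simp [hc, h.invol]

/-- In a tight frame with two cycles, `μ` sends adjacent vertices of a cycle to nonadjacent
vertices of the other cycle. -/
theorem mu_apply_cases (h : IsTightFrame G σ μ)
    (h2 : ∀ u v, permOrbit σ v = permOrbit σ u ∨ permOrbit σ v = permOrbit σ (μ u)) (u : V) :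
    μ (σ u) = σ (σ (μ u)) ∨ μ (σ u) = σ (σ (σ (μ u))) := by
  -- With only two cycles, any matching edge can serve as the selection. With `u` as representative,
  -- `σ u` is near and must be matched to a far vertex.
  obtain ⟨a, hs, hau⟩ := h.isSelection_of_two (h2 u)
  have h3 : IsNear σ a (σ u) := Or.inl (by rw [permOrbit_apply, hau])
  have h4 : permOrbit σ (μ (σ u)) = permOrbit σ (μ u) := by
    rcases h2 u (μ (σ u)) with h4 | h4
    · exact absurd (h4.trans (permOrbit_apply σ u).symm) (h.permOrbit_mu_ne (σ u))
    · exact h4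
  obtain ⟨h5, h6⟩ := h.not_isNear_mu_of_isNear hs h3
  have h7 : a (permOrbit σ (μ u)) = μ u := by
    have := hs.apply_mu (permOrbit σ u)
    rwa [hau] at this
  unfold IsNear at h5
  rw [h4, h7] at h5 h6
  rcases h.orbit_cases h4 with h8 | h8 | h8 | h8 | h8
  · exact absurd h8 h6
  · exact absurd (Or.inl h8) h5
  · exact Or.inl h8
  · exact Or.inr h8
  · exact absurd (Or.inr (by rw [h8, h.apply_five])) h5

end IsTightFrame

end NoCrossing

/-! ### Recognising the Petersen graph -/

section PetersenLabelling

/-- Cubic graphs with the same labelling of the 2-factor and the matching are isomorphic. -/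
theorem IsFrame.nonempty_iso {V W : Type*} [DecidableEq V] {G : SimpleGraph V}
    {σ : Equiv.Perm V} {μ : V → V} (hF : IsFrame G σ μ) {H : SimpleGraph W} {F : Fin 10 → V}
    (hFb : F.Bijective) {s m : Fin 10 → Fin 10} (hs : ∀ i, σ (F i) = F (s i))
    (hm : ∀ i, μ (F i) = F (m i)) {E : Fin 10 → W} (hE : E.Bijective)
    (hH : ∀ i j, H.Adj (E i) (E j) ↔ j = s i ∨ i = s j ∨ j = m i) : Nonempty (G ≃g H) := by
  let e : V ≃ W := (Equiv.ofBijective F hFb).symm.trans (Equiv.ofBijective E hE)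
  have he : ∀ i, e (F i) = E i := fun i => by
    simp only [e, Equiv.trans_apply, Equiv.ofBijective_apply]
    rw [Equiv.ofBijective_symm_apply_apply]
  refine ⟨⟨e, fun {u v} => ?_⟩⟩
  obtain ⟨i, rfl⟩ := hFb.2 u
  obtain ⟨j, rfl⟩ := hFb.2 v
  rw [he, he, hH, hF.adj, hs, hs, hm, hFb.1.eq_iff, hFb.1.eq_iff, hFb.1.eq_iff]

/-- The vertices of the Petersen graph, a pentagon followed by the complementary pentagon. -/
def petersenVertex : Fin 10 → {s : Finset (Fin 5) // s.card = 2} :=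
  ![⟨{0, 1}, rfl⟩, ⟨{2, 3}, rfl⟩, ⟨{4, 0}, rfl⟩, ⟨{1, 2}, rfl⟩, ⟨{3, 4}, rfl⟩,
    ⟨{2, 4}, rfl⟩, ⟨{3, 0}, rfl⟩, ⟨{4, 1}, rfl⟩, ⟨{0, 2}, rfl⟩, ⟨{1, 3}, rfl⟩]

/-- As `petersenVertex`, with the second pentagon reversed. -/
def petersenVertex' : Fin 10 → {s : Finset (Fin 5) // s.card = 2} :=
  ![⟨{0, 1}, rfl⟩, ⟨{2, 3}, rfl⟩, ⟨{4, 0}, rfl⟩, ⟨{1, 2}, rfl⟩, ⟨{3, 4}, rfl⟩,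
    ⟨{2, 4}, rfl⟩, ⟨{1, 3}, rfl⟩, ⟨{0, 2}, rfl⟩, ⟨{4, 1}, rfl⟩, ⟨{3, 0}, rfl⟩]

theorem petersenVertex_bijective : petersenVertex.Bijective :=
  (Fintype.bijective_iff_injective_and_card _).mpr ⟨by decide, by decide⟩

theorem petersenVertex'_bijective : petersenVertex'.Bijective :=
  (Fintype.bijective_iff_injective_and_card _).mpr ⟨by decide, by decide⟩

instance : DecidableRel petersenGraph.Adj := fun s t =>
  inferInstanceAs (Decidable (Disjoint s.1 t.1))

theorem IsTightFrame.nonempty_iso_petersenGraph {V : Type*} [Fintype V] [DecidableEq V]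
    {G : SimpleGraph V} {σ : Equiv.Perm V} {μ : V → V} (h : IsTightFrame G σ μ)
    {a : PermOrbit σ → V} (hs : IsSelection σ μ a) (hconn : G.Connected) :
    Nonempty (G ≃g petersenGraph) := by
  obtain ⟨u⟩ := hconn.nonempty
  have h2 := h.orbit_eq_or hs hconn
  have h5 := h.apply_five
  set w := μ u with hw
  have hwu : μ w = u := h.invol u
  have hinj : Function.Injective μ := (show Function.Involutive μ from h.invol).injective
  let F : Fin 10 → V := ![u, σ u, σ (σ u), σ (σ (σ u)), σ (σ (σ (σ u))),
    w, σ w, σ (σ w), σ (σ (σ w)), σ (σ (σ (σ w)))]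
  have hsurj : F.Surjective := by
    intro v
    rcases h2 u v with h3 | h3
    · rcases h.orbit_cases h3 with rfl | rfl | rfl | rfl | rfl
      exacts [⟨0, rfl⟩, ⟨1, rfl⟩, ⟨2, rfl⟩, ⟨3, rfl⟩, ⟨4, rfl⟩]
    · rcases h.orbit_cases h3 with rfl | rfl | rfl | rfl | rfl
      exacts [⟨5, rfl⟩, ⟨6, rfl⟩, ⟨7, rfl⟩, ⟨8, rfl⟩, ⟨9, rfl⟩]
  have hcard : Fintype.card V = 10 := by
    classical
    have h3 : oddOrbits σ = {permOrbit σ u, permOrbit σ w} := by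
      ext c
      obtain ⟨v, rfl⟩ := Quotient.exists_rep c
      simp only [h.mem_oddOrbits, Finset.mem_insert, Finset.mem_singleton, true_iff]
      exact h2 u v
    rw [h.card_eq, h3, Finset.card_pair (h.permOrbit_mu_ne u).symm]
  have hbij : F.Bijective := (Fintype.bijective_iff_surjective_and_card _).mpr
    ⟨hsurj, by rw [hcard, Fintype.card_fin]⟩
  have hσF : ∀ i, σ (F i) = F (![1, 2, 3, 4, 0, 6, 7, 8, 9, 5] i) := by
    intro i
    fin_cases i
    exacts [rfl, rfl, rfl, rfl, h5 u, rfl, rfl, rfl, rfl, h5 w]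
  have hstep := h.mu_apply_cases h2
  -- A step of 2 followed by a step of 3 would return to `μ x` on the pentagon, against injectivity.
  -- So all steps agree, and the two possibilities differ by reversing the second pentagon.
  have h22 : ∀ x, μ (σ x) = σ (σ (μ x)) → μ (σ (σ x)) = σ (σ (μ (σ x))) := by
    intro x hx
    refine (hstep (σ x)).resolve_right fun h' => ?_
    rw [hx, h5] at h'
    exact h.sq_ne x (hinj h')
  have h33 : ∀ x, μ (σ x) = σ (σ (σ (μ x))) → μ (σ (σ x)) = σ (σ (σ (μ (σ x)))) := by
    intro x hx
    refine (hstep (σ x)).resolve_left fun h' => ?_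
    rw [hx, h5] at h'
    exact h.sq_ne x (hinj h')
  have hback : ∀ x y, μ x = y → μ y = x := fun x y hxy => by rw [← hxy, h.invol]
  rcases hstep u with h1 | h1
  · have e1 := h1
    have e2 := h22 _ e1
    have e3 := h22 _ e2
    have e4 := h22 _ e3
    rw [← hw] at e1
    rw [e1] at e2
    rw [e2, h5] at e3
    rw [e3] at e4
    have hμF : ∀ i, μ (F i) = F (![5, 7, 9, 6, 8, 0, 3, 1, 4, 2] i) := by
      intro i
      fin_cases i
      exacts [rfl, e1, e2, e3, e4, hwu, hback _ _ e3, hback _ _ e1, hback _ _ e4, hback _ _ e2]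
    exact h.nonempty_iso hbij hσF hμF petersenVertex_bijective (by decide)
  · have e1 := h1
    have e2 := h33 _ e1
    have e3 := h33 _ e2
    have e4 := h33 _ e3
    rw [← hw] at e1
    rw [e1, h5] at e2
    rw [e2] at e3
    rw [e3, h5] at e4
    have hμF : ∀ i, μ (F i) = F (![5, 8, 6, 9, 7, 0, 2, 4, 1, 3] i) := by
      intro i
      fin_cases i
      exacts [rfl, e1, e2, e3, e4, hwu, hback _ _ e2, hback _ _ e4, hback _ _ e1, hback _ _ e3]
    exact h.nonempty_iso hbij hσF hμF petersenVertex'_bijective (by decide)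

/-- A frame in a connected graph other than the Petersen graph yields a colouring with fewer than
`4 / 5 * |V|` medium edges. -/
theorem IsFrame.exists_numMedium_lt {V : Type*} [Fintype V] [DecidableEq V] {G : SimpleGraph V}
    {σ : Equiv.Perm V} {μ : V → V} (hF : IsFrame G σ μ) (hconn : G.Connected)
    (hG : ¬ Nonempty (G ≃g petersenGraph)) :
    ∃ f : EdgeColouring G 4, 5 * f.numMedium < 4 * Fintype.card V := by
  have h1 := hF.five_mul_le_card
  by_contra hcon
  push Not at hcon
  obtain ⟨f, hf⟩ := hF.exists_numMedium_le
  have h2 := hcon f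
  have hcard : Fintype.card V = 5 * #(oddOrbits σ) := by omega
  have h3 : orbitUnion σ (oddOrbits σ) = Finset.univ := by
    rw [← Finset.card_eq_iff_eq_univ]
    exact le_antisymm (Finset.card_le_univ _) (hcard ▸ hF.five_mul_card_le subset_rfl)
  have hmem : ∀ c, c ∈ oddOrbits σ := by
    intro c
    obtain ⟨v, rfl⟩ := Quotient.exists_rep c
    have : v ∈ orbitUnion σ (oddOrbits σ) := by rw [h3]; simp
    exact mem_orbitUnion.mp this
  have h5 : ∀ c, #(orbitFinset σ c) = 5 := by
    have h4 : ∑ c ∈ oddOrbits σ, 5 = ∑ c ∈ oddOrbits σ, #(orbitFinset σ c) := by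
      rw [← card_orbitUnion, h3, Finset.card_univ, hcard, Finset.sum_const, smul_eq_mul, mul_comm]
    intro c
    exact ((Finset.sum_eq_sum_iff_of_le fun c hc => hF.five_le_card_orbit hc).mp h4 c
      (hmem c)).symm
  have htight : IsTightFrame G σ μ := ⟨hF, h5, fun f => by have := hcon f; omega⟩
  -- Since the number of vertices is exactly five times the number of odd cycles, no cycle need be
  -- left unmatched.
  obtain ⟨a, M, ha, hM, hMcard, hμ⟩ := hF.exists_selection (d := 0) (by simp) (by omega)
  have hMeq := Finset.eq_of_subset_of_card_le hM hMcard
  have hs : IsSelection σ μ a := ⟨ha, fun c => (hμ c (by rw [hMeq]; exact hmem c)).2.2⟩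
  exact hG (htight.nonempty_iso_petersenGraph hs hconn)

end PetersenLabelling

/-! ### The lower bound for the Petersen graph -/

section PetersenLowerBound

/-- `1` if the unordered pairs `a, b` and `c, d` agree and `0` otherwise. -/
def samePair (a b c d : Fin 4) : ℕ := if (a = c ∧ b = d) ∨ (a = d ∧ b = c) then 1 else 0

set_option synthInstance.maxHeartbeats 4000000 in
set_option synthInstance.maxSize 100000 in
set_option maxRecDepth 100000 in
set_option maxHeartbeats 4000000 in
/-- Edge colourings of the Petersen graph whose first three colours are `0`, `1`, `2` have at most
seven poor edges. -/
theorem petersen_poor_le :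
    ∀ c3 : Fin 4, c3 ≠ 0 →
    ∀ c4 : Fin 4, c4 ≠ 0 → c4 ≠ c3 →
    ∀ c5 : Fin 4, c5 ≠ c3 →
    ∀ c6 : Fin 4, c6 ≠ c3 → c6 ≠ c5 →
    ∀ c7 : Fin 4, c7 ≠ 1 → c7 ≠ c5 →
    ∀ c8 : Fin 4, c8 ≠ c5 → c8 ≠ c7 →
    ∀ c9 : Fin 4, c9 ≠ 1 → c9 ≠ c7 →
    ∀ c10 : Fin 4, c10 ≠ 2 → c10 ≠ c8 →
    ∀ c11 : Fin 4, c11 ≠ 2 → c11 ≠ c6 → c11 ≠ c10 →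
    ∀ c12 : Fin 4, c12 ≠ c4 → c12 ≠ c8 → c12 ≠ c10 →
    ∀ c13 : Fin 4, c13 ≠ c4 → c13 ≠ c9 → c13 ≠ c12 →
    ∀ c14 : Fin 4, c14 ≠ c6 → c14 ≠ c9 → c14 ≠ c11 → c14 ≠ c13 →
    samePair 1 2 c3 c4 +
    samePair 0 2 c7 c9 +
    samePair 0 1 c10 c11 +
    samePair 0 c4 c5 c6 +
    samePair 0 c3 c12 c13 +
    samePair c3 c6 c7 c8 +
    samePair c3 c5 c11 c14 +
    samePair c5 c8 1 c9 +
    samePair c5 c7 c10 c12 +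
    samePair 1 c7 c13 c14 +
    samePair 2 c11 c8 c12 +
    samePair 2 c10 c6 c14 +
    samePair c8 c10 c4 c13 +
    samePair c4 c12 c9 c14 +
    samePair c9 c13 c6 c11 ≤ 7 := by
  -- Each colour is followed at once by its constraints, so the enumeration drops improper partial
  -- colourings early.
  decide +kernel

/-- The first ends of the edges of the Petersen graph. -/
def petersenFst : Fin 15 → Fin 10 := ![0, 0, 0, 1, 1, 2, 2, 3, 3, 4, 5, 5, 6, 7, 8]

/-- The second ends of the edges of the Petersen graph. -/
def petersenSnd : Fin 15 → Fin 10 := ![1, 4, 5, 2, 7, 3, 9, 4, 6, 8, 6, 9, 7, 8, 9]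

/-- The edges adjacent to an edge of the Petersen graph, two at the first end followed by two at
the second end. -/
def petersenNext : Fin 4 → Fin 15 → Fin 15 :=
  ![![1, 0, 0, 0, 0, 3, 3, 5, 5, 1, 2, 2, 8, 4, 9],
    ![2, 2, 1, 4, 3, 6, 5, 8, 7, 7, 11, 10, 10, 12, 13],
    ![3, 7, 10, 5, 12, 7, 11, 1, 10, 13, 8, 6, 4, 9, 6],
    ![4, 9, 11, 6, 13, 8, 14, 9, 12, 14, 12, 14, 13, 14, 11]]

/-- Two edges of the Petersen graph are different and have a common end. -/
def PetersenTouch (i j : Fin 15) : Prop :=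
  i ≠ j ∧ (petersenFst i = petersenFst j ∨ petersenFst i = petersenSnd j ∨
    petersenSnd i = petersenFst j ∨ petersenSnd i = petersenSnd j)

instance : DecidableRel PetersenTouch := fun i j => by
  unfold PetersenTouch
  infer_instance

theorem sum_samePair_le {k : Fin 15 → Fin 4} (hk : ∀ i j, PetersenTouch i j → k i ≠ k j) :
    ∑ j, samePair (k (petersenNext 0 j)) (k (petersenNext 1 j)) (k (petersenNext 2 j))
      (k (petersenNext 3 j)) ≤ 7 := by
  -- The edges 0, 1, 2 meet at a vertex, so their colours are distinct and can be renamed 0, 1, 2;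
  -- the renaming does not affect `samePair`.
  let π : Fin 4 → Fin 4 := fun x => if x = k 0 then 0 else if x = k 1 then 1 else
    if x = k 2 then 2 else 3
  have hne1 : k 1 ≠ k 0 := hk 1 0 (by decide)
  have hne2 : k 2 ≠ k 0 := hk 2 0 (by decide)
  have hne3 : k 2 ≠ k 1 := hk 2 1 (by decide)
  have hπ : Function.Injective π := by
    have key : ∀ a b c : Fin 4, b ≠ a → c ≠ a → c ≠ b → ∀ x y : Fin 4,
        (if x = a then (0 : Fin 4) else if x = b then 1 else if x = c then 2 else 3) =
        (if y = a then (0 : Fin 4) else if y = b then 1 else if y = c then 2 else 3) → x = y := by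
      decide +kernel
    exact fun x y => key _ _ _ hne1 hne2 hne3 x y
  have hπ0 : π (k 0) = 0 := by simp [π]
  have hπ1 : π (k 1) = 1 := by simp [π, hne1]
  have hπ2 : π (k 2) = 2 := by simp [π, hne2, hne3]
  have hsame : ∀ a b c d, samePair (π a) (π b) (π c) (π d) = samePair a b c d := by
    intro a b c d
    simp only [samePair, hπ.eq_iff]
  have hp : ∀ i j, PetersenTouch i j → π (k i) ≠ π (k j) := fun i j h h' => hk i j h (hπ h')
  have hp0 : ∀ i, PetersenTouch i 0 → π (k i) ≠ 0 := fun i h => hπ0 ▸ hp i 0 h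
  have hp1 : ∀ i, PetersenTouch i 1 → π (k i) ≠ 1 := fun i h => hπ1 ▸ hp i 1 h
  have hp2 : ∀ i, PetersenTouch i 2 → π (k i) ≠ 2 := fun i h => hπ2 ▸ hp i 2 h
  have hsum : ∀ g : Fin 15 → ℕ, ∑ j, g j =
      g 0 + g 1 + g 2 + g 3 + g 4 + g 5 + g 6 + g 7 + g 8 + g 9 + g 10 + g 11 + g 12 + g 13 + g 14 := by
    intro g
    simp only [Fin.sum_univ_castSucc, Fin.sum_univ_zero, zero_add]
    rfl
  have := petersen_poor_le
    (π (k 3)) (hp0 3 (by decide))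
    (π (k 4)) (hp0 4 (by decide)) (hp 4 3 (by decide))
    (π (k 5)) (hp 5 3 (by decide))
    (π (k 6)) (hp 6 3 (by decide)) (hp 6 5 (by decide))
    (π (k 7)) (hp1 7 (by decide)) (hp 7 5 (by decide))
    (π (k 8)) (hp 8 5 (by decide)) (hp 8 7 (by decide))
    (π (k 9)) (hp1 9 (by decide)) (hp 9 7 (by decide))
    (π (k 10)) (hp2 10 (by decide)) (hp 10 8 (by decide))
    (π (k 11)) (hp2 11 (by decide)) (hp 11 6 (by decide)) (hp 11 10 (by decide))
    (π (k 12)) (hp 12 4 (by decide)) (hp 12 8 (by decide)) (hp 12 10 (by decide))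
    (π (k 13)) (hp 13 4 (by decide)) (hp 13 9 (by decide)) (hp 13 12 (by decide))
    (π (k 14)) (hp 14 6 (by decide)) (hp 14 9 (by decide)) (hp 14 11 (by decide)) (hp 14 13 (by decide))
  rw [← hπ0, ← hπ1, ← hπ2] at this
  simp only [hsame] at this
  rw [hsum]
  exact this

/-- Two different pairs show at least three colours, and the colour of `e` itself is excluded, so
exactly three appear. -/
theorem EdgeColouring.isMedium_of_not_samePair {V : Type*} {G : SimpleGraph V}
    {f : EdgeColouring G 4} {e p q r t : G.edgeSet} (hp : G.lineGraph.Adj e p)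
    (hq : G.lineGraph.Adj e q) (hr : G.lineGraph.Adj e r) (ht : G.lineGraph.Adj e t)
    (hpq : f p ≠ f q) (hrt : f r ≠ f t) (h : samePair (f p) (f q) (f r) (f t) = 0) :
    f.IsMedium e := by
  have h1 : ↑({f p, f q, f r, f t} : Finset (Fin 4)) ⊆ f.adjacentColours e := by
    intro c hc
    simp only [Finset.coe_insert, Finset.coe_singleton, Set.mem_insert_iff,
      Set.mem_singleton_iff] at hc
    rcases hc with rfl | rfl | rfl | rfl
    exacts [⟨p, hp, rfl⟩, ⟨q, hq, rfl⟩, ⟨r, hr, rfl⟩, ⟨t, ht, rfl⟩]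
  have h2 : f.adjacentColours e ⊆ ↑({f e}ᶜ : Finset (Fin 4)) := by
    rintro _ ⟨e', he', rfl⟩
    simpa using fun h' => f.valid he' h'.symm
  have h3 := Set.ncard_le_ncard h1 (Set.toFinite _)
  have h4 := Set.ncard_le_ncard h2 (Set.toFinite _)
  rw [Set.ncard_coe_finset] at h3 h4
  have h5 : 3 ≤ #({f p, f q, f r, f t} : Finset (Fin 4)) := by
    have key : ∀ a b c d : Fin 4, a ≠ b → c ≠ d → samePair a b c d = 0 →
        3 ≤ #({a, b, c, d} : Finset (Fin 4)) := by
      decide +kernel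
    exact key _ _ _ _ hpq hrt h
  have h6 : #({f e}ᶜ : Finset (Fin 4)) = 3 := by
    rw [Finset.card_compl, Finset.card_singleton, Fintype.card_fin]
  unfold EdgeColouring.IsMedium EdgeColouring.IsRich EdgeColouring.IsPoor
  omega

theorem eight_le_numMedium {V : Type*} [Finite V] {G : SimpleGraph V} (φ : G ≃g petersenGraph)
    (f : EdgeColouring G 4) : 8 ≤ f.numMedium := by
  classical
  let x : Fin 10 → V := fun i => φ.symm (petersenVertex i)
  have hx : Function.Injective x := φ.symm.injective.comp petersenVertex_bijective.1
  have hadj : ∀ j, G.Adj (x (petersenFst j)) (x (petersenSnd j)) := by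
    intro j
    simp only [x]
    rw [φ.symm.map_adj_iff]
    revert j
    decide
  let e : Fin 15 → G.edgeSet := fun j => ⟨s(x (petersenFst j), x (petersenSnd j)), hadj j⟩
  have he : Function.Injective e := by
    intro i j hij
    have h1 : Sym2.map x s(petersenFst i, petersenSnd i) =
        Sym2.map x s(petersenFst j, petersenSnd j) := congrArg Subtype.val hij
    have h2 := Sym2.map.injective hx h1
    revert i j
    have key : ∀ i j, s(petersenFst i, petersenSnd i) = s(petersenFst j, petersenSnd j) → i = j := by
      decide +kernel
    exact fun i j _ _ h2 => key i j h2
  have hline : ∀ i j, PetersenTouch i j → G.lineGraph.Adj (e i) (e j) := by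
    rintro i j ⟨hne, h⟩
    rw [SimpleGraph.lineGraph_adj_iff_exists]
    refine ⟨fun h' => hne (he h'), ?_⟩
    simp only [e, Sym2.mem_iff]
    rcases h with h | h | h | h
    exacts [⟨_, Or.inl rfl, Or.inl (by rw [h])⟩, ⟨_, Or.inl rfl, Or.inr (by rw [h])⟩,
      ⟨_, Or.inr rfl, Or.inl (by rw [h])⟩, ⟨_, Or.inr rfl, Or.inr (by rw [h])⟩]
  have hsum := sum_samePair_le (k := fun j => f (e j)) fun i j h => f.valid (hline i j h)
  have htouch : ∀ n j, PetersenTouch j (petersenNext n j) := by decide +kernel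
  have htouch01 : ∀ j, PetersenTouch (petersenNext 0 j) (petersenNext 1 j) := by decide +kernel
  have htouch23 : ∀ j, PetersenTouch (petersenNext 2 j) (petersenNext 3 j) := by decide +kernel
  set S : Finset (Fin 15) := {j | samePair (f (e (petersenNext 0 j))) (f (e (petersenNext 1 j)))
    (f (e (petersenNext 2 j))) (f (e (petersenNext 3 j))) = 0} with hS
  have h1 : 8 ≤ #S := by
    have h2 : #Sᶜ ≤ ∑ j, samePair (f (e (petersenNext 0 j))) (f (e (petersenNext 1 j)))
        (f (e (petersenNext 2 j))) (f (e (petersenNext 3 j))) := by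
      rw [Finset.card_eq_sum_ones]
      refine (Finset.sum_le_sum fun j hj => ?_).trans
        (Finset.sum_le_sum_of_subset (Finset.subset_univ Sᶜ))
      simp only [hS, Finset.mem_compl, Finset.mem_filter, Finset.mem_univ, true_and] at hj
      omega
    have h3 := Finset.card_add_card_compl S
    rw [Fintype.card_fin] at h3
    omega
  refine h1.trans ?_
  unfold EdgeColouring.numMedium
  rw [← Finset.card_image_of_injective S he, ← Set.ncard_coe_finset]
  refine Set.ncard_le_ncard ?_ (Set.toFinite _)
  intro d hd
  rw [Finset.mem_coe, Finset.mem_image] at hd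
  obtain ⟨j, hj, rfl⟩ := hd
  exact EdgeColouring.isMedium_of_not_samePair (hline _ _ (htouch 0 j)) (hline _ _ (htouch 1 j))
    (hline _ _ (htouch 2 j)) (hline _ _ (htouch 3 j)) (f.valid (hline _ _ (htouch01 j)))
    (f.valid (hline _ _ (htouch23 j))) (Finset.mem_filter.mp hj).2

end PetersenLowerBound

theorem theorem1p3 {V : Type*} [Fintype V] (G : SimpleGraph V) [DecidableRel G.Adj]
    (hconn : G.Connected) (hcubic : G.IsRegularOfDegree 3) (hbridgeless : IsBridgeless G) :
    (∃ f : EdgeColouring G 4,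
      (EdgeColouring.numMedium f : ℚ) ≤ 4 / 5 * (Fintype.card V : ℚ)) ∧
    ((∀ f : EdgeColouring G 4,
        4 / 5 * (Fintype.card V : ℚ) ≤ (EdgeColouring.numMedium f : ℚ)) ↔
      Nonempty (G ≃g petersenGraph)) := by
  classical
  have := hconn.nonempty
  obtain ⟨σ, μ, hF⟩ := exists_isFrame G hcubic hbridgeless
  refine ⟨?_, fun h => ?_, ?_⟩
  · obtain ⟨f, hf⟩ := hF.exists_numMedium_le
    have hf' : (5 * f.numMedium : ℚ) ≤ 4 * Fintype.card V := by
      exact_mod_cast le_trans (Nat.le_add_right _ _) hf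
    exact ⟨f, by linarith⟩
  · by_contra hG
    obtain ⟨f, hf⟩ := hF.exists_numMedium_lt hconn hG
    have hf' : (5 * f.numMedium : ℚ) < 4 * Fintype.card V := by exact_mod_cast hf
    linarith [h f]
  · rintro ⟨φ⟩ f
    have hcard : Fintype.card V = 10 :=
      (Fintype.card_congr φ.toEquiv).trans (Fintype.card_of_bijective petersenVertex_bijective).symm
    have hf : (8 : ℚ) ≤ f.numMedium := by exact_mod_cast eight_le_numMedium φ f
    rw [hcard]
    push_cast
    linarith
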